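/- Let $\mathcal D$ be a strongly self-absorbing $C^*$-algebra, that is, a separable, unital, infinite-dimensional $C^*$-algebra for which there are an isomorphism $\varphi\colon\mathcal D\to\mathcal D\otimes\mathcal D$ and a sequence of unitaries $u_n\in\mathcal D\otimes\mathcal D$ with $u_n(d\otimes 1)u_n^*\to\varphi(d)$ in norm for every $d\in\mathcal D$. Let $A$ be a separable unital $C^*$-algebra (with $1\neq 0$) which is $\mathcal D$-absorbing, that is, $A\otimes\mathcal D\cong A$. (All tensor products are minimal $C^*$-tensor products.) Let $\mathbb T=\{\zeta\in\mathbb C\colon|\zeta|=1\}$ and let $\alpha\colon\mathbb T\to\mathrm{Aut}(A)$ be an action, continuous for the topology of pointwise norm convergence, with the Rokhlin property: for every finite subset $F\subseteq A$ and every $\varepsilon>0$ there is a unitary $u\in A$ such that $\|\alpha_\zeta(u)-\zeta u\|<\varepsilon$ for all $\zeta\in\mathbb T$ and $\|ua-au\|<\varepsilon$ for all $a\in F$. For an integer $n\geq 1$, let $\alpha|_n\colon\mathbb Z_n\to\mathrm{Aut}(A)$, $k\mapsto\alpha_{e^{2\pi i k/n}}$, be the restriction of $\alpha$ to the $n$-th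 roots of unity. Then, for every integer $n\geq 1$, the crossed product $A\rtimes_{\alpha|_n}\mathbb Z_n$ is a unital (with $1\neq0$), separable, $\mathcal D$-absorbing $C^*$-algebra. -/

import Mathlib

open scoped TensorProduct InnerProductSpace
open Filter Topology

universe u

noncomputable section

/-! ### The minimal (spatial) tensor product of two unital C⋆-algebras -/

/-- A (unital) representation of a unital C⋆-algebra on a complex Hilbert space. -/
structure HilbertRep (A : Type u) [CStarAlgebra A] where
  /-- The Hilbert space. -/
  space : Type u
  [normedAddCommGroup : NormedAddCommGroup space]
  [innerProductSpace : InnerProductSpace ℂ space]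
  [completeSpace : CompleteSpace space]
  /-- The representation. -/
  rep : A →⋆ₐ[ℂ] (space →L[ℂ] space)

attribute [instance] HilbertRep.normedAddCommGroup HilbertRep.innerProductSpace
  HilbertRep.completeSpace

section HilbertTensor

variable (H K : Type u) [NormedAddCommGroup H] [InnerProductSpace ℂ H]
  [NormedAddCommGroup K] [InnerProductSpace ℂ K]

/-- The Hilbert space tensor product: the completion of the algebraic tensor product for the inner
product `⟪h ⊗ k, h' ⊗ k'⟫ = ⟪h, h'⟫ ⟪k, k'⟫`. -/
def HilbertTensor : Type u := UniformSpace.Completion (H ⊗[ℂ] K)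

instance : NormedAddCommGroup (HilbertTensor H K) :=
  inferInstanceAs (NormedAddCommGroup (UniformSpace.Completion (H ⊗[ℂ] K)))

instance : InnerProductSpace ℂ (HilbertTensor H K) :=
  inferInstanceAs (InnerProductSpace ℂ (UniformSpace.Completion (H ⊗[ℂ] K)))

instance : CompleteSpace (HilbertTensor H K) :=
  inferInstanceAs (CompleteSpace (UniformSpace.Completion (H ⊗[ℂ] K)))

variable {H K}

/-- The elementary tensor `h ⊗ k`. -/
def HilbertTensor.tmul (h : H) (k : K) : HilbertTensor H K :=
  ((h ⊗ₜ[ℂ] k : H ⊗[ℂ] K) : UniformSpace.Completion (H ⊗[ℂ] K))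

/-- The tensor product `S ⊗ T` of two bounded operators. -/
def HilbertTensor.map (S : H →L[ℂ] H) (T : K →L[ℂ] K) :
    HilbertTensor H K →L[ℂ] HilbertTensor H K :=
  (TensorProduct.mapL S T).completion

theorem HilbertTensor.map_tmul (S : H →L[ℂ] H) (T : K →L[ℂ] K) (h : H) (k : K) :
    HilbertTensor.map S T (.tmul h k) = .tmul (S h) (T k) := by
  refine (ContinuousLinearMap.completion_apply_coe _ _).trans ?_
  simp [HilbertTensor.tmul]

theorem HilbertTensor.inner_tmul (h h' : H) (k k' : K) :
    ⟪HilbertTensor.tmul h k, HilbertTensor.tmul h' k'⟫_ℂ = ⟪h, h'⟫_ℂ * ⟪k, k'⟫_ℂ :=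
  (UniformSpace.Completion.inner_coe _ _).trans (TensorProduct.inner_tmul ..)

theorem HilbertTensor.ext {E : Type*} [NormedAddCommGroup E] [NormedSpace ℂ E]
    {S T : HilbertTensor H K →L[ℂ] E}
    (hST : ∀ h k, S (.tmul h k) = T (.tmul h k)) : S = T := by
  have key : ∀ z : H ⊗[ℂ] K, S (z : UniformSpace.Completion (H ⊗[ℂ] K)) =
      T (z : UniformSpace.Completion (H ⊗[ℂ] K)) := by
    intro z
    induction z with
    | zero =>
      rw [UniformSpace.Completion.coe_zero]
      exact (map_zero S).trans (map_zero T).symm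
    | add x y hx hy =>
      rw [UniformSpace.Completion.coe_add]
      exact (map_add S _ _).trans ((congrArg₂ _ hx hy).trans (map_add T _ _).symm)
    | tmul h k => exact hST h k
  ext x
  exact UniformSpace.Completion.induction_on (p := fun x => S x = T x) x
    (isClosed_eq S.continuous T.continuous) key

theorem HilbertTensor.norm_map_le (S : H →L[ℂ] H) (T : K →L[ℂ] K) :
    ‖HilbertTensor.map S T‖ ≤ ‖S‖ * ‖T‖ := by
  refine ContinuousLinearMap.opNorm_le_bound _ (by positivity) fun x => ?_
  refine UniformSpace.Completion.induction_on
    (p := fun x => ‖HilbertTensor.map S T x‖ ≤ ‖S‖ * ‖T‖ * ‖(x : HilbertTensor H K)‖) x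
    (isClosed_le (by fun_prop) (by fun_prop)) fun z => ?_
  have h1 : HilbertTensor.map S T (z : UniformSpace.Completion (H ⊗[ℂ] K)) =
      ((TensorProduct.mapL S T z : H ⊗[ℂ] K) : UniformSpace.Completion (H ⊗[ℂ] K)) :=
    ContinuousLinearMap.completion_apply_coe _ _
  rw [h1]
  refine (UniformSpace.Completion.norm_coe _).trans_le ?_
  refine (ContinuousLinearMap.le_of_opNorm_le _ (TensorProduct.norm_mapL_le S T) z).trans_eq ?_
  exact congrArg _ (UniformSpace.Completion.norm_coe z).symm

theorem HilbertTensor.tmul_add (h : H) (k k' : K) :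
    HilbertTensor.tmul h (k + k') = .tmul h k + .tmul h k' :=
  (congrArg _ (TensorProduct.tmul_add h k k')).trans (UniformSpace.Completion.coe_add _ _)

theorem HilbertTensor.add_tmul (h h' : H) (k : K) :
    HilbertTensor.tmul (h + h') k = .tmul h k + .tmul h' k :=
  (congrArg _ (TensorProduct.add_tmul h h' k)).trans (UniformSpace.Completion.coe_add _ _)

theorem HilbertTensor.smul_tmul (c : ℂ) (h : H) (k : K) :
    HilbertTensor.tmul (c • h) k = c • .tmul h k :=
  (congrArg _ (TensorProduct.smul_tmul' c h k).symm).trans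
    (UniformSpace.Completion.coe_smul _ _)

theorem HilbertTensor.tmul_smul (c : ℂ) (h : H) (k : K) :
    HilbertTensor.tmul h (c • k) = c • .tmul h k :=
  (congrArg _ (TensorProduct.tmul_smul c h k)).trans
    (UniformSpace.Completion.coe_smul _ _)

theorem HilbertTensor.star_map [CompleteSpace H] [CompleteSpace K]
    (S : H →L[ℂ] H) (T : K →L[ℂ] K) :
    star (HilbertTensor.map S T) = HilbertTensor.map (star S) (star T) := by
  refine HilbertTensor.ext fun h k => ?_
  have key : innerSL ℂ (star (HilbertTensor.map S T) (.tmul h k)) =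
      innerSL ℂ (HilbertTensor.map (star S) (star T) (.tmul h k)) := by
    refine HilbertTensor.ext fun h' k' => ?_
    simp only [innerSL_apply_apply, ContinuousLinearMap.star_eq_adjoint,
      ContinuousLinearMap.adjoint_inner_left, HilbertTensor.map_tmul, HilbertTensor.inner_tmul]
  exact ext_inner_right ℂ fun x => congrArg (fun f => f x) key

end HilbertTensor

section Spatial

variable {A D : Type u} [CStarAlgebra A] [CStarAlgebra D]

/-- The representation `a ↦ π(a) ⊗ 1` on `H ⊗ K`. -/
def HilbertRep.tensorLeft (π : HilbertRep A) (K : Type u) [NormedAddCommGroup K]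
    [InnerProductSpace ℂ K] :
    A →ₐ[ℂ] (HilbertTensor π.space K →L[ℂ] HilbertTensor π.space K) :=
  AlgHom.ofLinearMap
    { toFun := fun a => HilbertTensor.map (π.rep a) 1
      map_add' := fun a b => HilbertTensor.ext fun h k => by
        simp [HilbertTensor.map_tmul, HilbertTensor.add_tmul]
      map_smul' := fun c a => HilbertTensor.ext fun h k => by
        simp [HilbertTensor.map_tmul, HilbertTensor.smul_tmul] }
    (HilbertTensor.ext fun h k => by simp [HilbertTensor.map_tmul])
    (fun a b => HilbertTensor.ext fun h k => by simp [HilbertTensor.map_tmul])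

/-- The representation `d ↦ 1 ⊗ ρ(d)` on `H ⊗ K`. -/
def HilbertRep.tensorRight (H : Type u) [NormedAddCommGroup H] [InnerProductSpace ℂ H]
    (ρ : HilbertRep D) :
    D →ₐ[ℂ] (HilbertTensor H ρ.space →L[ℂ] HilbertTensor H ρ.space) :=
  AlgHom.ofLinearMap
    { toFun := fun d => HilbertTensor.map 1 (ρ.rep d)
      map_add' := fun a b => HilbertTensor.ext fun h k => by
        simp [HilbertTensor.map_tmul, HilbertTensor.tmul_add]
      map_smul' := fun c a => HilbertTensor.ext fun h k => by
        simp [HilbertTensor.map_tmul, HilbertTensor.tmul_smul] }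
    (HilbertTensor.ext fun h k => by simp [HilbertTensor.map_tmul])
    (fun a b => HilbertTensor.ext fun h k => by simp [HilbertTensor.map_tmul])

theorem HilbertRep.commute_tensor (π : HilbertRep A) (ρ : HilbertRep D) (a : A) (d : D) :
    Commute (π.tensorLeft ρ.space a) (ρ.tensorRight π.space d) :=
  HilbertTensor.ext fun h k => by
    simp [HilbertRep.tensorLeft, HilbertRep.tensorRight, HilbertTensor.map_tmul]

/-- The tensor product `π ⊗ ρ` of two representations, as a representation of the algebraic tensor
product on the Hilbert space tensor product. It sends `a ⊗ d` to `π(a) ⊗ ρ(d)`. -/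
def HilbertRep.tensor (π : HilbertRep A) (ρ : HilbertRep D) :
    A ⊗[ℂ] D →ₐ[ℂ]
      (HilbertTensor π.space ρ.space →L[ℂ] HilbertTensor π.space ρ.space) :=
  Algebra.TensorProduct.lift (π.tensorLeft ρ.space) (ρ.tensorRight π.space) (π.commute_tensor ρ)

theorem HilbertRep.tensor_tmul (π : HilbertRep A) (ρ : HilbertRep D) (a : A) (d : D) :
    π.tensor ρ (a ⊗ₜ d) = HilbertTensor.map (π.rep a) (ρ.rep d) := by
  rw [HilbertRep.tensor, Algebra.TensorProduct.lift_tmul]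
  exact HilbertTensor.ext fun h k => by
    simp [HilbertRep.tensorLeft, HilbertRep.tensorRight, HilbertTensor.map_tmul]

theorem HilbertRep.tensor_star (π : HilbertRep A) (ρ : HilbertRep D) (z : A ⊗[ℂ] D) :
    π.tensor ρ (star z) = star (π.tensor ρ z) := by
  induction z with
  | zero => simp
  | add x y hx hy => simp [hx, hy]
  | tmul a d =>
    simp [TensorProduct.star_tmul, HilbertRep.tensor_tmul, HilbertTensor.star_map, map_star]

/-- The spatial C⋆-seminorm on the algebraic tensor product: the supremum of `‖(π ⊗ ρ)(z)‖` over
all representations `π` of `A` and `ρ` of `D`. -/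
def spatialNorm (z : A ⊗[ℂ] D) : ℝ :=
  ⨆ p : HilbertRep A × HilbertRep D, ‖p.1.tensor p.2 z‖

theorem spatialNorm_bddAbove (z : A ⊗[ℂ] D) :
    BddAbove (Set.range fun p : HilbertRep A × HilbertRep D => ‖p.1.tensor p.2 z‖) := by
  suffices h : ∃ C : ℝ, ∀ p : HilbertRep A × HilbertRep D, ‖p.1.tensor p.2 z‖ ≤ C by
    obtain ⟨C, hC⟩ := h
    exact ⟨C, by rintro _ ⟨p, rfl⟩; exact hC p⟩
  induction z with
  | zero => exact ⟨0, fun p => by simp⟩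
  | add x y hx hy =>
    obtain ⟨C, hC⟩ := hx
    obtain ⟨C', hC'⟩ := hy
    exact ⟨C + C', fun p => by
      rw [map_add]; exact (norm_add_le _ _).trans (add_le_add (hC p) (hC' p))⟩
  | tmul a d =>
    refine ⟨‖a‖ * ‖d‖, fun p => ?_⟩
    rw [HilbertRep.tensor_tmul]
    refine (HilbertTensor.norm_map_le _ _).trans ?_
    gcongr
    · exact NonUnitalStarAlgHom.norm_apply_le p.1.rep a
    · exact NonUnitalStarAlgHom.norm_apply_le p.2.rep d

theorem le_spatialNorm (p : HilbertRep A × HilbertRep D) (z : A ⊗[ℂ] D) :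
    ‖p.1.tensor p.2 z‖ ≤ spatialNorm z :=
  le_ciSup (spatialNorm_bddAbove z) p

theorem spatialNorm_nonneg (z : A ⊗[ℂ] D) : 0 ≤ spatialNorm z :=
  Real.iSup_nonneg fun _ => norm_nonneg _

theorem spatialNorm_zero : spatialNorm (0 : A ⊗[ℂ] D) = 0 := by
  simp [spatialNorm]

theorem spatialNorm_neg (z : A ⊗[ℂ] D) : spatialNorm (-z) = spatialNorm z := by
  simp [spatialNorm]

theorem spatialNorm_star (z : A ⊗[ℂ] D) : spatialNorm (star z) = spatialNorm z := by
  simp [spatialNorm, HilbertRep.tensor_star]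

theorem spatialNorm_add_le (y z : A ⊗[ℂ] D) :
    spatialNorm (y + z) ≤ spatialNorm y + spatialNorm z := by
  refine Real.iSup_le (fun p => ?_) (add_nonneg (spatialNorm_nonneg y) (spatialNorm_nonneg z))
  rw [map_add]
  exact (norm_add_le _ _).trans (add_le_add (le_spatialNorm p y) (le_spatialNorm p z))

theorem spatialNorm_mul_le (y z : A ⊗[ℂ] D) :
    spatialNorm (y * z) ≤ spatialNorm y * spatialNorm z := by
  refine Real.iSup_le (fun p => ?_) (mul_nonneg (spatialNorm_nonneg y) (spatialNorm_nonneg z))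
  rw [map_mul]
  exact (norm_mul_le _ _).trans
    (mul_le_mul (le_spatialNorm p y) (le_spatialNorm p z) (norm_nonneg _) (spatialNorm_nonneg y))

theorem spatialNorm_smul_le (c : ℂ) (z : A ⊗[ℂ] D) :
    spatialNorm (c • z) ≤ ‖c‖ * spatialNorm z := by
  refine Real.iSup_le (fun p => ?_) (mul_nonneg (norm_nonneg c) (spatialNorm_nonneg z))
  rw [map_smul, norm_smul]
  exact mul_le_mul_of_nonneg_left (le_spatialNorm p z) (norm_nonneg c)

theorem tensor_star_mul (y z : A ⊗[ℂ] D) : star (y * z) = star z * star y := by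
  induction y with
  | zero => simp
  | add y y' hy hy' => simp [add_mul, mul_add, hy, hy']
  | tmul a d =>
    induction z with
    | zero => simp
    | add z z' hz hz' => simp [add_mul, mul_add, hz, hz']
    | tmul b e => simp [TensorProduct.star_tmul]

theorem spatialNorm_mul_self_le (z : A ⊗[ℂ] D) :
    spatialNorm z * spatialNorm z ≤ spatialNorm (star z * z) := by
  have h : spatialNorm z ≤ √(spatialNorm (star z * z)) := by
    refine Real.iSup_le (fun p => Real.le_sqrt_of_sq_le ?_) (Real.sqrt_nonneg _)
    rw [sq, ← CStarRing.norm_star_mul_self, ← HilbertRep.tensor_star, ← map_mul]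
    exact le_spatialNorm p _
  exact (mul_self_le_mul_self (spatialNorm_nonneg z) h).trans_eq
    (Real.mul_self_sqrt (spatialNorm_nonneg _))

variable (A D) in
/-- The algebraic tensor product `A ⊗ D`, equipped with the spatial C⋆-seminorm. -/
def SpatialAlg : Type u := A ⊗[ℂ] D

instance : Ring (SpatialAlg A D) := inferInstanceAs (Ring (A ⊗[ℂ] D))

instance : Algebra ℂ (SpatialAlg A D) := inferInstanceAs (Algebra ℂ (A ⊗[ℂ] D))

instance : StarRing (SpatialAlg A D) where
  star z := Star.star (R := A ⊗[ℂ] D) z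
  star_involutive z := star_star (R := A ⊗[ℂ] D) z
  star_mul y z := tensor_star_mul (A := A) (D := D) y z
  star_add y z := star_add (R := A ⊗[ℂ] D) y z

instance : StarModule ℂ (SpatialAlg A D) where
  star_smul c z := star_smul (A := A ⊗[ℂ] D) c z

instance : SeminormedRing (SpatialAlg A D) :=
  RingSeminorm.toSeminormedRing
    { toFun := fun z => spatialNorm (A := A) (D := D) z
      map_zero' := spatialNorm_zero
      add_le' := spatialNorm_add_le
      neg' := spatialNorm_neg
      mul_le' := spatialNorm_mul_le }

theorem SpatialAlg.norm_def (z : SpatialAlg A D) :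
    ‖z‖ = spatialNorm (A := A) (D := D) z := rfl

instance : NormedAlgebra ℂ (SpatialAlg A D) where
  norm_smul_le c z := spatialNorm_smul_le (A := A) (D := D) c z

instance : NormedStarGroup (SpatialAlg A D) where
  norm_star_le z := (spatialNorm_star (A := A) (D := D) z).le

variable (A D) in
/-- The minimal (spatial) tensor product of two unital C⋆-algebras: the completion of the
algebraic tensor product in the spatial norm. -/
def MinTensor : Type u := UniformSpace.Completion (SpatialAlg A D)

namespace MinTensor

instance : NormedRing (MinTensor A D) :=
  inferInstanceAs (NormedRing (UniformSpace.Completion (SpatialAlg A D)))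

instance : Algebra ℂ (MinTensor A D) :=
  inferInstanceAs (Algebra ℂ (UniformSpace.Completion (SpatialAlg A D)))

instance : CompleteSpace (MinTensor A D) :=
  inferInstanceAs (CompleteSpace (UniformSpace.Completion (SpatialAlg A D)))

instance : NormedAlgebra ℂ (MinTensor A D) where
  norm_smul_le c x := norm_smul_le (β := UniformSpace.Completion (SpatialAlg A D)) c x

/-- The canonical map from the algebraic tensor product to the minimal tensor product. -/
def ofAlg : SpatialAlg A D →ₐ[ℂ] MinTensor A D where
  toFun z := (z : UniformSpace.Completion (SpatialAlg A D))
  map_one' := UniformSpace.Completion.coe_one _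
  map_mul' := UniformSpace.Completion.coe_mul
  map_zero' := UniformSpace.Completion.coe_zero
  map_add' := UniformSpace.Completion.coe_add
  commutes' _ := rfl

theorem norm_ofAlg (z : SpatialAlg A D) : ‖ofAlg z‖ = ‖z‖ :=
  UniformSpace.Completion.norm_coe z

theorem denseRange_ofAlg : DenseRange (ofAlg : SpatialAlg A D → MinTensor A D) :=
  UniformSpace.Completion.denseRange_coe

/-- The involution, extended by continuity from the algebraic tensor product. -/
instance : Star (MinTensor A D) where
  star := UniformSpace.Completion.map (star : SpatialAlg A D → SpatialAlg A D)

theorem continuous_star' : Continuous (star : MinTensor A D → MinTensor A D) :=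
  UniformSpace.Completion.continuous_map

theorem star_ofAlg (z : SpatialAlg A D) : star (ofAlg z) = ofAlg (star z) :=
  UniformSpace.Completion.map_coe
    star_isometry.uniformContinuous z

theorem induction_on {p : MinTensor A D → Prop} (x : MinTensor A D)
    (hp : IsClosed {x | p x}) (h : ∀ z, p (ofAlg z)) : p x :=
  UniformSpace.Completion.induction_on x hp h

instance : StarRing (MinTensor A D) where
  star_involutive x := by
    refine induction_on (p := fun x => star (star x) = x) x (isClosed_eq ?_ continuous_id)
      fun z => ?_
    · exact continuous_star'.comp continuous_star'
    · rw [star_ofAlg, star_ofAlg, star_star]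
  star_mul x y := by
    refine induction_on (p := fun x => star (x * y) = star y * star x) x (isClosed_eq ?_ ?_)
      fun z => ?_
    · exact continuous_star'.comp (continuous_id.mul continuous_const)
    · exact continuous_const.mul continuous_star'
    refine induction_on (p := fun y => star (ofAlg z * y) = star y * star (ofAlg z)) y
      (isClosed_eq ?_ ?_) fun w => ?_
    · exact continuous_star'.comp (continuous_const.mul continuous_id)
    · exact continuous_star'.mul continuous_const
    rw [← map_mul, star_ofAlg, star_ofAlg, star_ofAlg, star_mul, map_mul]
  star_add x y := by
    refine induction_on (p := fun x => star (x + y) = star x + star y) x (isClosed_eq ?_ ?_)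
      fun z => ?_
    · exact continuous_star'.comp (continuous_id.add continuous_const)
    · exact continuous_star'.add continuous_const
    refine induction_on (p := fun y => star (ofAlg z + y) = star (ofAlg z) + star y) y
      (isClosed_eq ?_ ?_) fun w => ?_
    · exact continuous_star'.comp (continuous_const.add continuous_id)
    · exact continuous_const.add continuous_star'
    rw [← map_add, star_ofAlg, star_ofAlg, star_ofAlg, star_add, map_add]

instance : StarModule ℂ (MinTensor A D) where
  star_smul c x := by
    refine induction_on (p := fun x => star (c • x) = star c • star x) x (isClosed_eq ?_ ?_)
      fun z => ?_
    · exact continuous_star'.comp (continuous_const_smul c)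
    · exact (continuous_star' (A := A) (D := D)).const_smul (star c)
    rw [← map_smul, star_ofAlg, star_ofAlg, star_smul, map_smul]

instance : CStarRing (MinTensor A D) where
  norm_mul_self_le x := by
    refine induction_on (p := fun x => ‖x‖ * ‖x‖ ≤ ‖star x * x‖) x (isClosed_le ?_ ?_)
      fun z => ?_
    · exact continuous_norm.mul continuous_norm
    · exact continuous_norm.comp (continuous_star'.mul continuous_id)
    rw [star_ofAlg, ← map_mul, norm_ofAlg, norm_ofAlg]
    exact spatialNorm_mul_self_le (A := A) (D := D) z

instance : CStarAlgebra (MinTensor A D) where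

/-- The elementary tensor `a ⊗ d` in the minimal tensor product. -/
def tmul (a : A) (d : D) : MinTensor A D := ofAlg (a ⊗ₜ[ℂ] d : A ⊗[ℂ] D)

variable (A D) in
/-- The first-factor embedding `a ↦ a ⊗ 1`. -/
def inl : A →⋆ₐ[ℂ] MinTensor A D where
  toFun a := tmul a 1
  map_one' := map_one ofAlg
  map_mul' a b := by
    refine Eq.trans ?_ (map_mul ofAlg _ _)
    refine congrArg ofAlg (Eq.trans ?_ (Algebra.TensorProduct.tmul_mul_tmul a b (1 : D) 1).symm)
    rw [one_mul]
  map_zero' := (congrArg ofAlg (TensorProduct.zero_tmul A (1 : D))).trans (map_zero ofAlg)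
  map_add' a b := (congrArg ofAlg (TensorProduct.add_tmul a b (1 : D))).trans (map_add ofAlg _ _)
  commutes' c := by
    refine Eq.trans ?_ (AlgHom.commutes ofAlg c)
    rfl
  map_star' a := by
    refine Eq.trans ?_ (star_ofAlg _).symm
    refine congrArg ofAlg (Eq.trans ?_ (TensorProduct.star_tmul a (1 : D)).symm)
    rw [star_one]

end MinTensor

end Spatial

/-! ### Strongly self-absorbing C⋆-algebras -/

section SelfAbsorbing

/-- Two unital ⋆-homomorphisms `φ, ψ : A → B` are approximately unitarily equivalent if there are
unitaries `uₙ` in `B` such that `uₙ φ(a) uₙ* → ψ(a)` for every `a`. (This is the sequential form,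
used for separable `A`.) -/
def ApproxUnitarilyEquivalent {A B : Type u} [CStarAlgebra A] [CStarAlgebra B]
    (φ ψ : A →⋆ₐ[ℂ] B) : Prop :=
  ∃ w : ℕ → unitary B, ∀ a : A,
    Tendsto (fun n => (w n : B) * φ a * star (w n : B)) atTop (𝓝 (ψ a))

/-- A unital separable C⋆-algebra `D` is strongly self-absorbing if it is infinite-dimensional and
`d ↦ d ⊗ 1` is approximately unitarily equivalent to an isomorphism `D → D ⊗ D`. -/
structure IsStronglySelfAbsorbing (D : Type u) [CStarAlgebra D] : Prop where
  separable : TopologicalSpace.SeparableSpace D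
  infinite_dimensional : ¬ FiniteDimensional ℂ D
  exists_equiv : ∃ φ : D ≃⋆ₐ[ℂ] MinTensor D D,
    ApproxUnitarilyEquivalent (MinTensor.inl D D) (φ : D →⋆ₐ[ℂ] MinTensor D D)

/-- `A` is `D`-absorbing if `A ⊗ D` is isomorphic to `A`. -/
def IsAbsorbing (D A : Type u) [CStarAlgebra D] [CStarAlgebra A] : Prop :=
  Nonempty (MinTensor A D ≃⋆ₐ[ℂ] A)

end SelfAbsorbing

/-! ### Crossed products by finite groups -/

section CrossedProduct

variable {A : Type u} [CStarAlgebra A] {G : Type} [Group G] [Fintype G] [DecidableEq G]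

attribute [local instance] CStarAlgebra.spectralOrder CStarAlgebra.spectralOrderedRing

/-- The canonical copy of `a ∈ A` in the regular representation of `(A, G, α)` on `⊕_G A`: the
diagonal matrix with entries `α_{g⁻¹}(a)`. -/
def crossedDiag (α : G →* (A ≃⋆ₐ[ℂ] A)) (a : A) : CStarMatrix G G A :=
  CStarMatrix.ofMatrix (Matrix.diagonal fun g => α g⁻¹ a)

variable (A) in
/-- The canonical unitary implementing `s ∈ G`: the permutation matrix of left translation by `s`
on `⊕_G A`. -/
def crossedUnitary (s : G) : CStarMatrix G G A :=
  CStarMatrix.ofMatrix (Matrix.of fun g h => if g = s * h then 1 else 0)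

/-- The C⋆-algebra generated by `A` and the canonical unitaries, acting on `⊕_G A`. -/
def crossedSubalgebra (α : G →* (A ≃⋆ₐ[ℂ] A)) : StarSubalgebra ℂ (CStarMatrix G G A) :=
  (StarAlgebra.adjoin ℂ
    (Set.range (crossedDiag α) ∪ Set.range (crossedUnitary A (G := G)))).topologicalClosure

/-- The crossed product `A ⋊_α G` of a unital C⋆-algebra by an action of a finite group, realized
through the regular representation. (The group being finite, the full and the reduced crossed
products agree.) -/
def CrossedProduct (α : G →* (A ≃⋆ₐ[ℂ] A)) : Type u := crossedSubalgebra α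

instance (α : G →* (A ≃⋆ₐ[ℂ] A)) : CStarAlgebra (CrossedProduct α) :=
  haveI : IsClosed (crossedSubalgebra α : Set (CStarMatrix G G A)) :=
    StarSubalgebra.isClosed_topologicalClosure _
  inferInstanceAs (CStarAlgebra (crossedSubalgebra α))

end CrossedProduct

/-! ### Circle actions -/

section CircleActions

variable {A : Type u} [CStarAlgebra A]

/-- A homomorphism from the circle to `Aut(A)` is a continuous action if it is continuous for the
topology of pointwise norm convergence. -/
def IsContinuousAction (α : Circle →* (A ≃⋆ₐ[ℂ] A)) : Prop :=
  ∀ a : A, Continuous fun ζ : Circle => α ζ a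

/-- The Rokhlin property for a circle action. -/
def HasRokhlinProperty (α : Circle →* (A ≃⋆ₐ[ℂ] A)) : Prop :=
  ∀ (F : Finset A) (ε : ℝ), 0 < ε → ∃ w ∈ unitary A,
    (∀ ζ : Circle, ‖α ζ w - (ζ : ℂ) • w‖ < ε) ∧ ∀ a ∈ F, ‖w * a - a * w‖ < ε

/-- The restriction of a circle action to the cyclic group `ℤ/n`, identified with the `n`-th roots
of unity through `k ↦ exp(2πik/n)`. -/
def restrictCyclic (α : Circle →* (A ≃⋆ₐ[ℂ] A)) (n : ℕ) [NeZero n] :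
    Multiplicative (ZMod n) →* (A ≃⋆ₐ[ℂ] A) :=
  α.comp (ZMod.toCircle (N := n)).toMonoidHom

end CircleActions

end

/-!
If `A ≅ A ⊗ D`, there are unitaries `v` in `A ⊗ D` which almost commute with `A ⊗ 1` and conjugate
`1 ⊗ D` almost into `A ⊗ 1`. An almost central unitary `u` of `A` with `α ζ u ≈ ζ u` yields an
almost equivariant, almost central homomorphism `C(𝕋) → A`, and with it an approximately
multiplicative way of transporting functions in `C(𝕋, A ⊗ D)` to `A ⊗ D`. The orbit function
`ζ ↦ (α ζ⁻¹ ⊗ id) v` is fixed by the diagonal action of the circle, so it is transported to an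
almost `α`-invariant unitary `w` which still almost commutes with `A ⊗ 1` and conjugates `1 ⊗ D`
almost into `A ⊗ 1`. By invariance `w` also almost commutes with the canonical unitaries of the
crossed product `B = A ⋊ ℤ/n`. Hence `w` almost commutes with `B ⊗ 1` and conjugates `B ⊗ D` almost
into `B ⊗ 1`, and an approximate intertwining turns the embedding `B → B ⊗ D` into an isomorphism.
-/

open scoped CStarAlgebra

theorem separableSpace_of_forall_isClosed_eq_top {E : Type*} [NormedRing E] [NormedAlgebra ℂ E]
    {s : Set E} (hs : TopologicalSpace.IsSeparable s)
    (h : ∀ S : Subalgebra ℂ E, IsClosed (S : Set E) → s ⊆ S → S = ⊤) :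
    TopologicalSpace.SeparableSpace E := by
  obtain ⟨c, hc, hsc⟩ := hs
  have h_monoid : (Submonoid.closure c : Set E).Countable := by
    have : Countable c := hc
    have : Countable (FreeMonoid c) := inferInstanceAs (Countable (List c))
    rw [Submonoid.closure_eq_mrange]
    exact Set.countable_range _
  have h_adjoin : TopologicalSpace.IsSeparable (Algebra.adjoin ℂ c : Set E) := by
    rw [← Subalgebra.coe_toSubmodule, Algebra.adjoin_eq_span]
    exact h_monoid.isSeparable.span
  have h_top : (Algebra.adjoin ℂ c).topologicalClosure = ⊤ :=
    h _ (Subalgebra.isClosed_topologicalClosure _)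
      (hsc.trans (closure_mono Algebra.subset_adjoin))
  rw [← TopologicalSpace.isSeparable_univ_iff, ← Algebra.coe_top (R := ℂ), ← h_top]
  exact h_adjoin.closure

namespace MinTensor

variable {A B C D : Type u} [CStarAlgebra A] [CStarAlgebra B] [CStarAlgebra C] [CStarAlgebra D]

theorem tmul_mul_tmul (a b : A) (d e : D) : tmul a d * tmul b e = tmul (a * b) (d * e) :=
  (map_mul ofAlg _ _).symm.trans
    (congrArg ofAlg (Algebra.TensorProduct.tmul_mul_tmul a b d e))

theorem star_tmul (a : A) (d : D) : star (tmul a d) = tmul (star a) (star d) :=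
  (star_ofAlg _).trans (congrArg ofAlg (TensorProduct.star_tmul a d))

theorem one_tmul_one : tmul (1 : A) (1 : D) = 1 := map_one ofAlg

theorem tmul_smul (c : ℂ) (a : A) (d : D) : tmul a (c • d) = c • tmul a d :=
  (congrArg ofAlg (TensorProduct.tmul_smul c a d)).trans (map_smul ofAlg c _)

theorem tmul_add (a : A) (d e : D) : tmul a (d + e) = tmul a d + tmul a e :=
  (congrArg ofAlg (TensorProduct.tmul_add a d e)).trans (map_add ofAlg _ _)

theorem tmul_zero (a : A) : tmul a (0 : D) = 0 :=
  (congrArg ofAlg (TensorProduct.tmul_zero D a)).trans (map_zero ofAlg)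

theorem inl_apply (a : A) : inl A D a = tmul a 1 := rfl

variable (A D) in
/-- The second-factor embedding `d ↦ 1 ⊗ d`. -/
noncomputable def inr : D →⋆ₐ[ℂ] MinTensor A D where
  toFun d := tmul 1 d
  map_one' := one_tmul_one
  map_mul' d e := by rw [tmul_mul_tmul, one_mul]
  map_zero' := tmul_zero 1
  map_add' d e := tmul_add 1 d e
  commutes' c := by
    rw [Algebra.algebraMap_eq_smul_one, Algebra.algebraMap_eq_smul_one, tmul_smul, one_tmul_one]
  map_star' d := by rw [star_tmul, star_one]

theorem inr_apply (d : D) : inr A D d = tmul 1 d := rfl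

theorem inl_mul_inr (a : A) (d : D) : inl A D a * inr A D d = tmul a d := by
  rw [inl_apply, inr_apply, tmul_mul_tmul, mul_one, one_mul]

theorem commute_inl_inr (a : A) (d : D) : Commute (inl A D a) (inr A D d) := by
  rw [commute_iff_eq, inl_mul_inr, inl_apply, inr_apply, tmul_mul_tmul, mul_one, one_mul]

theorem subalgebra_eq_top {S : Subalgebra ℂ (MinTensor A D)}
    (hS : IsClosed (S : Set (MinTensor A D))) (hinl : ∀ a, inl A D a ∈ S)
    (hinr : ∀ d, inr A D d ∈ S) : S = ⊤ := by
  refine eq_top_iff.2 fun x _ => induction_on x hS fun z => ?_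
  refine TensorProduct.induction_on (motive := fun z => ofAlg (z : SpatialAlg A D) ∈ S) z ?_ ?_ ?_
  · exact (map_zero (ofAlg (A := A) (D := D))).symm ▸ S.zero_mem
  · intro a d
    exact (inl_mul_inr a d).subst (motive := (· ∈ S)) (S.mul_mem (hinl a) (hinr d))
  · exact fun y z hy hz => (map_add (ofAlg (A := A) (D := D)) y z).symm ▸ S.add_mem hy hz

theorem hom_ext {f g : MinTensor A D →⋆ₐ[ℂ] C} (hinl : ∀ a, f (inl A D a) = g (inl A D a))
    (hinr : ∀ d, f (inr A D d) = g (inr A D d)) : f = g := by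
  have h : AlgHom.equalizer f.toAlgHom g.toAlgHom = ⊤ :=
    subalgebra_eq_top (isClosed_eq (map_continuous f) (map_continuous g)) hinl hinr
  ext x
  exact (h ▸ Algebra.mem_top : x ∈ AlgHom.equalizer f.toAlgHom g.toAlgHom)

theorem separableSpace [TopologicalSpace.SeparableSpace A] [TopologicalSpace.SeparableSpace D] :
    TopologicalSpace.SeparableSpace (MinTensor A D) :=
  separableSpace_of_forall_isClosed_eq_top
    ((TopologicalSpace.isSeparable_range (map_continuous (inl A D))).union
      (TopologicalSpace.isSeparable_range (map_continuous (inr A D))))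
    fun _ hS h => subalgebra_eq_top hS (fun a => h (Or.inl ⟨a, rfl⟩)) fun d => h (Or.inr ⟨d, rfl⟩)

/-- The extension to `A ⊗ D` of a homomorphism `f` on the algebraic tensor product which is
contractive for the spatial norm; it suffices that `f` preserves adjoints of elementary tensors. -/
noncomputable def lift (f : A ⊗[ℂ] D →ₐ[ℂ] C) (hnorm : ∀ z, ‖f z‖ ≤ spatialNorm z)
    (hstar : ∀ a d, f (star a ⊗ₜ star d) = star (f (a ⊗ₜ d))) : MinTensor A D →⋆ₐ[ℂ] C :=
  have hf : Continuous (show SpatialAlg A D →ₐ[ℂ] C from f) :=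
    AddMonoidHomClass.continuous_of_bound (show SpatialAlg A D →ₐ[ℂ] C from f) 1
      fun z => (hnorm z).trans_eq (one_mul _).symm
  let F : MinTensor A D →+* C :=
    UniformSpace.Completion.extensionHom (α := SpatialAlg A D) f.toRingHom hf
  have hF : Continuous F := UniformSpace.Completion.continuous_extension
  have hF_coe : ∀ z : SpatialAlg A D, F (ofAlg z) = f z :=
    UniformSpace.Completion.extensionHom_coe (α := SpatialAlg A D) f.toRingHom hf
  have hf_star : ∀ z : A ⊗[ℂ] D, f (star z) = star (f z) := fun z => by
    induction z with
    | zero => simp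
    | tmul a d => rw [TensorProduct.star_tmul, hstar]
    | add y z hy hz => rw [star_add, map_add, map_add, star_add, hy, hz]
  { F with
    commutes' c := (hF_coe _).trans (f.commutes c)
    map_star' x := induction_on (p := fun x => F (star x) = star (F x)) x
      (isClosed_eq (hF.comp continuous_star') (continuous_star.comp hF)) fun z => by
        rw [star_ofAlg, hF_coe, hF_coe]; exact hf_star z }

theorem lift_tmul (f : A ⊗[ℂ] D →ₐ[ℂ] C) (hnorm : ∀ z, ‖f z‖ ≤ spatialNorm z)
    (hstar : ∀ a d, f (star a ⊗ₜ star d) = star (f (a ⊗ₜ d))) (a : A) (d : D) :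
    lift f hnorm hstar (tmul a d) = f (a ⊗ₜ d) :=
  UniformSpace.Completion.extensionHom_coe (α := SpatialAlg A D) f.toRingHom
    (AddMonoidHomClass.continuous_of_bound (show SpatialAlg A D →ₐ[ℂ] C from f) 1
      fun z => (hnorm z).trans_eq (one_mul _).symm) (a ⊗ₜ d)

end MinTensor

/-- The restriction of a representation along a `⋆`-homomorphism. -/
noncomputable def HilbertRep.comp {A B : Type u} [CStarAlgebra A] [CStarAlgebra B]
    (π : HilbertRep B) (f : A →⋆ₐ[ℂ] B) : HilbertRep A where
  space := π.space
  rep := π.rep.comp f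

namespace MinTensor

variable {A B C D : Type u} [CStarAlgebra A] [CStarAlgebra B] [CStarAlgebra C] [CStarAlgebra D]

theorem spatialNorm_map_le (f : A →⋆ₐ[ℂ] B) (g : D →⋆ₐ[ℂ] C) (z : A ⊗[ℂ] D) :
    spatialNorm (Algebra.TensorProduct.map f.toAlgHom g.toAlgHom z) ≤ spatialNorm z := by
  refine Real.iSup_le (fun p => ?_) (spatialNorm_nonneg z)
  refine le_trans (le_of_eq (congrArg _ ?_)) (le_spatialNorm (p.1.comp f, p.2.comp g) z)
  induction z with
  | zero => exact (congrArg _ (map_zero _)).trans ((map_zero _).trans (map_zero _).symm)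
  | add x y hx hy =>
    rw [map_add, map_add, hx, hy]
    exact (map_add _ _ _).symm
  | tmul a d =>
    rw [Algebra.TensorProduct.map_tmul, HilbertRep.tensor_tmul]
    exact (HilbertRep.tensor_tmul (p.1.comp f) (p.2.comp g) a d).symm

/-- The tensor product of two `⋆`-homomorphisms. -/
noncomputable def map (f : A →⋆ₐ[ℂ] B) (g : D →⋆ₐ[ℂ] C) : MinTensor A D →⋆ₐ[ℂ] MinTensor B C :=
  lift ((ofAlg : B ⊗[ℂ] C →ₐ[ℂ] MinTensor B C).comp
      (Algebra.TensorProduct.map f.toAlgHom g.toAlgHom))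
    (fun z => (norm_ofAlg _).trans_le (spatialNorm_map_le f g z))
    (fun a d => (congrArg₂ tmul (map_star f a) (map_star g d)).trans (star_tmul _ _).symm)

theorem map_tmul (f : A →⋆ₐ[ℂ] B) (g : D →⋆ₐ[ℂ] C) (a : A) (d : D) :
    map f g (tmul a d) = tmul (f a) (g d) :=
  lift_tmul _ _ _ _ _

theorem map_inl (f : A →⋆ₐ[ℂ] B) (g : D →⋆ₐ[ℂ] C) (a : A) :
    map f g (inl A D a) = inl B C (f a) := by
  rw [inl_apply, map_tmul, map_one, inl_apply]

theorem map_inr (f : A →⋆ₐ[ℂ] B) (g : D →⋆ₐ[ℂ] C) (d : D) :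
    map f g (inr A D d) = inr B C (g d) := by
  rw [inr_apply, map_tmul, map_one, inr_apply]

end MinTensor

namespace HilbertTensor

variable {H K : Type u} [NormedAddCommGroup H] [InnerProductSpace ℂ H] [NormedAddCommGroup K]
  [InnerProductSpace ℂ K]

variable (H K) in
/-- The flip `h ⊗ k ↦ k ⊗ h` of Hilbert space tensor products. -/
noncomputable def swap : HilbertTensor H K →L[ℂ] HilbertTensor K H :=
  (TensorProduct.commIsometry ℂ H K).toLinearIsometry.toContinuousLinearMap.completion

theorem swap_tmul (h : H) (k : K) : swap H K (tmul h k) = tmul k h :=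
  (ContinuousLinearMap.completion_apply_coe _ _).trans (by simp [tmul])

theorem norm_swap_le : ‖swap H K‖ ≤ 1 := by
  refine ContinuousLinearMap.opNorm_le_bound _ zero_le_one fun x => ?_
  refine UniformSpace.Completion.induction_on
    (p := fun x => ‖swap H K x‖ ≤ 1 * ‖(x : HilbertTensor H K)‖) x
    (isClosed_le (by fun_prop) (by fun_prop)) fun z => ?_
  have hz : swap H K (z : UniformSpace.Completion (H ⊗[ℂ] K)) =
      ((TensorProduct.comm ℂ H K z : K ⊗[ℂ] H) : UniformSpace.Completion (K ⊗[ℂ] H)) :=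
    ContinuousLinearMap.completion_apply_coe _ _
  rw [hz, one_mul]
  exact (UniformSpace.Completion.norm_coe _).trans_le
    ((TensorProduct.norm_comm z).trans_le (UniformSpace.Completion.norm_coe z).symm.le)

end HilbertTensor

namespace MinTensor

variable {A D : Type u} [CStarAlgebra A] [CStarAlgebra D]

theorem spatialNorm_comm_le (z : A ⊗[ℂ] D) :
    spatialNorm (Algebra.TensorProduct.comm ℂ A D z) ≤ spatialNorm z := by
  refine Real.iSup_le (fun p => ?_) (spatialNorm_nonneg z)
  have h_swap : p.1.tensor p.2 (Algebra.TensorProduct.comm ℂ A D z) =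
      (HilbertTensor.swap _ _).comp ((p.2.tensor p.1 z).comp (HilbertTensor.swap _ _)) := by
    induction z with
    | zero => simp
    | add x y hx hy =>
      rw [map_add, map_add, map_add, hx, hy, ContinuousLinearMap.add_comp,
        ContinuousLinearMap.comp_add]
    | tmul a d =>
      refine HilbertTensor.ext fun h k => ?_
      simp [HilbertRep.tensor_tmul, HilbertTensor.map_tmul, HilbertTensor.swap_tmul]
  rw [h_swap]
  calc _ ≤ 1 * (‖p.2.tensor p.1 z‖ * 1) :=
        (ContinuousLinearMap.opNorm_comp_le _ _).trans (mul_le_mul HilbertTensor.norm_swap_le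
          ((ContinuousLinearMap.opNorm_comp_le _ _).trans
            (mul_le_mul_of_nonneg_left HilbertTensor.norm_swap_le (norm_nonneg _)))
          (norm_nonneg _) zero_le_one)
    _ ≤ spatialNorm z := by simpa using le_spatialNorm (p.2, p.1) z

variable (A D) in
/-- The flip `a ⊗ d ↦ d ⊗ a`. -/
noncomputable def swap : MinTensor A D →⋆ₐ[ℂ] MinTensor D A :=
  lift ((ofAlg : D ⊗[ℂ] A →ₐ[ℂ] MinTensor D A).comp (Algebra.TensorProduct.comm ℂ A D).toAlgHom)
    (fun z => (norm_ofAlg _).trans_le (spatialNorm_comm_le z))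
    (fun _ _ => (star_tmul _ _).symm)

theorem swap_tmul (a : A) (d : D) : swap A D (tmul a d) = tmul d a :=
  lift_tmul _ _ _ _ _

theorem swap_inl (a : A) : swap A D (inl A D a) = inr D A a := swap_tmul _ _

theorem swap_inr (d : D) : swap A D (inr A D d) = inl D A d := swap_tmul _ _

end MinTensor

section States

attribute [local instance] CStarAlgebra.spectralOrder CStarAlgebra.spectralOrderedRing

variable {B : Type*} [CStarAlgebra B] [Nontrivial B]

theorem norm_one_add_of_nonneg {a : B} (ha : 0 ≤ a) : ‖1 + a‖ = 1 + ‖a‖ := by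
  refine le_antisymm ((norm_add_le _ _).trans_eq (by rw [CStarRing.norm_one])) ?_
  have h_one : 1 ≤ ‖1 + a‖ := by
    simpa only [CStarRing.norm_one] using
      CStarAlgebra.norm_le_norm_of_nonneg_of_le zero_le_one (le_add_of_nonneg_right ha)
  have h_le : 1 + a ≤ algebraMap ℝ B ‖1 + a‖ :=
    IsSelfAdjoint.le_algebraMap_norm_self (.of_nonneg (add_nonneg zero_le_one ha))
  have h_sub : ‖a‖ ≤ ‖1 + a‖ - 1 := by
    rw [CStarAlgebra.norm_le_iff_le_algebraMap a (by linarith), map_sub, map_one]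
    exact le_sub_iff_add_le'.2 h_le
  linarith

theorem norm_add_I_smul_one_sq_le {a : B} (ha : IsSelfAdjoint a) (t : ℝ) :
    ‖a + (Complex.I * t) • 1‖ ^ 2 ≤ ‖a‖ ^ 2 + t ^ 2 := by
  have h_mul : star (a + (Complex.I * t) • 1) * (a + (Complex.I * t) • 1) =
      a * a + ((t : ℂ) ^ 2) • (1 : B) := by
    simp only [star_add, star_smul, star_one, ha.star_eq, add_mul, mul_add, smul_mul_assoc,
      mul_smul_comm, one_mul, mul_one, Complex.star_def, map_mul, Complex.conj_ofReal,
      Complex.conj_I]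
    match_scalars
    · ring
    · ring
    · linear_combination -(t : ℂ) ^ 2 * Complex.I_sq
  calc ‖a + (Complex.I * t) • 1‖ ^ 2 = ‖a * a + ((t : ℂ) ^ 2) • (1 : B)‖ := by
        rw [sq, ← CStarRing.norm_star_mul_self, h_mul]
    _ ≤ ‖a‖ * ‖a‖ + ‖(t : ℂ) ^ 2‖ * ‖(1 : B)‖ :=
        (norm_add_le _ _).trans (add_le_add (norm_mul_le _ _) (norm_smul_le _ _))
    _ = ‖a‖ ^ 2 + t ^ 2 := by simp [sq]

variable {f : B →L[ℂ] ℂ}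

theorem im_map_eq_zero_of_norm_le_one (hf : ‖f‖ ≤ 1) (hf_one : f 1 = 1) {a : B}
    (ha : IsSelfAdjoint a) : (f a).im = 0 := by
  have h_shift : ∀ t : ℝ, ((f a).im + t) ^ 2 ≤ ‖a‖ ^ 2 + t ^ 2 := fun t => by
    have h_le : ‖f (a + (Complex.I * t) • 1)‖ ≤ ‖a + (Complex.I * t) • 1‖ :=
      (f.le_of_opNorm_le hf _).trans_eq (one_mul _)
    have h_im : (f (a + (Complex.I * t) • 1)).im = (f a).im + t := by simp [hf_one]
    have h_abs := h_im ▸ (Complex.abs_im_le_norm (f (a + (Complex.I * t) • 1))).trans h_le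
    exact (sq_le_sq' (abs_le.1 h_abs).1 (abs_le.1 h_abs).2).trans (norm_add_I_smul_one_sq_le ha t)
  by_contra h
  have h_large := h_shift (‖a‖ ^ 2 / (f a).im)
  have h_cancel : (f a).im * (‖a‖ ^ 2 / (f a).im) = ‖a‖ ^ 2 := mul_div_cancel₀ _ h
  nlinarith [sq_nonneg ‖a‖, sq_pos_of_ne_zero h]

open scoped ComplexOrder in
theorem map_nonneg_of_norm_le_one (hf : ‖f‖ ≤ 1) (hf_one : f 1 = 1) {a : B} (ha : 0 ≤ a) :
    0 ≤ f a := by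
  refine Complex.nonneg_iff.2
    ⟨?_, (im_map_eq_zero_of_norm_le_one hf hf_one (.of_nonneg ha)).symm⟩
  have h_norm : ‖algebraMap ℝ B ‖a‖ - a‖ ≤ ‖a‖ := by
    rw [CStarAlgebra.norm_le_iff_le_algebraMap _ (norm_nonneg a)
      (sub_nonneg.2 (IsSelfAdjoint.le_algebraMap_norm_self (.of_nonneg ha)))]
    exact sub_le_self _ ha
  have h_map : f (algebraMap ℝ B ‖a‖ - a) = ‖a‖ - f a := by
    rw [map_sub, Algebra.algebraMap_eq_smul_one, ← Complex.coe_smul, map_smul, hf_one,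
      smul_eq_mul, mul_one]
  have h_re := (Complex.re_le_norm _).trans ((f.le_of_opNorm_le hf (algebraMap ℝ B ‖a‖ - a)).trans
    ((one_mul _).trans_le h_norm))
  rw [h_map, Complex.sub_re, Complex.ofReal_re] at h_re
  linarith

open scoped ComplexOrder in
theorem exists_positiveLinearMap_apply_eq_norm {a : B} (ha : 0 ≤ a) :
    ∃ f : B →ₚ[ℂ] ℂ, f a = ‖a‖ := by
  obtain ⟨f, hf, hf_norming⟩ := exists_dual_vector'' ℂ (1 + a)
  have h_norm_a : ‖f a‖ ≤ ‖a‖ := (f.le_of_opNorm_le hf a).trans_eq (one_mul _)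
  have h_norm_one : ‖f 1‖ ≤ 1 := by
    simpa only [CStarRing.norm_one, mul_one] using f.le_of_opNorm_le hf 1
  rw [norm_one_add_of_nonneg ha, map_add] at hf_norming
  have h_re : (f 1).re + (f a).re = 1 + ‖a‖ := by simpa using congrArg Complex.re hf_norming
  have h_re_a := (Complex.re_le_norm (f a)).trans h_norm_a
  have hf_one : f 1 = 1 := by
    have h_re_one : (f 1).re = 1 :=
      le_antisymm ((Complex.re_le_norm _).trans h_norm_one) (by linarith)
    have h_nonneg : 0 ≤ f 1 := Complex.re_eq_norm.1
      (le_antisymm (Complex.re_le_norm _) (h_norm_one.trans_eq h_re_one.symm))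
    exact Complex.ext h_re_one (Complex.nonneg_iff.1 h_nonneg).2.symm
  refine ⟨PositiveLinearMap.mk₀ f fun x hx => map_nonneg_of_norm_le_one hf hf_one hx, ?_⟩
  rw [hf_one] at hf_norming
  push_cast at hf_norming
  exact add_left_cancel hf_norming

open scoped ComplexOrder in
theorem exists_hilbertRep_ne_zero {B : Type u} [CStarAlgebra B] {b : B} (hb : b ≠ 0) :
    ∃ π : HilbertRep B, π.rep b ≠ 0 := by
  have : Nontrivial B := ⟨b, 0, hb⟩
  obtain ⟨f, hf⟩ := exists_positiveLinearMap_apply_eq_norm (star_mul_self_nonneg b)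
  refine ⟨{ space := f.GNS, rep := f.gnsStarAlgHom }, fun h => ?_⟩
  have h_coe : ((f.toPreGNS b : f.PreGNS) : f.GNS) = 0 := by
    have h_apply : f.gnsNonUnitalStarAlgHom b ((f.toPreGNS 1 : f.PreGNS) : f.GNS) = 0 :=
      congrArg (fun T : f.GNS →L[ℂ] f.GNS => T (f.toPreGNS 1 : f.PreGNS)) h
    simpa [PositiveLinearMap.gnsNonUnitalStarAlgHom_apply_coe,
      PositiveLinearMap.leftMulMapPreGNS_apply] using h_apply
  have h_norm : ‖(f.toPreGNS b : f.PreGNS)‖ = 0 := by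
    rw [← UniformSpace.Completion.norm_coe, h_coe, norm_zero]
  have h_zero : f (star b * b) = 0 := by
    simpa [h_norm] using (f.preGNS_norm_sq (f.toPreGNS b)).symm
  rw [hf, Complex.ofReal_eq_zero, CStarRing.norm_star_mul_self, mul_self_eq_zero,
    norm_eq_zero] at h_zero
  exact hb h_zero

end States

namespace MinTensor

variable {A D : Type u} [CStarAlgebra A] [CStarAlgebra D]

theorem inl_injective [Nontrivial D] : Function.Injective (inl A D) := by
  refine (injective_iff_map_eq_zero _).2 fun a ha => by_contra fun h => ?_
  obtain ⟨π, hπ⟩ := exists_hilbertRep_ne_zero h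
  obtain ⟨ρ, hρ⟩ := exists_hilbertRep_ne_zero (one_ne_zero (α := D))
  obtain ⟨k, hk⟩ : ∃ k, ρ.rep 1 k ≠ 0 := by
    by_contra! h_zero
    exact hρ (ContinuousLinearMap.ext h_zero)
  refine hπ (ContinuousLinearMap.ext fun x => ?_)
  have h_spatial : spatialNorm (a ⊗ₜ[ℂ] (1 : D)) = 0 :=
    (norm_ofAlg (A := A) (D := D) _).symm.trans ((congrArg norm ha).trans norm_zero)
  have h_rep : π.tensor ρ (a ⊗ₜ 1) = 0 :=
    norm_le_zero_iff.1 ((le_spatialNorm (π, ρ) _).trans_eq h_spatial)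
  have h_tmul : HilbertTensor.tmul (π.rep a x) (ρ.rep 1 k) = 0 := by
    rw [← HilbertTensor.map_tmul, ← HilbertRep.tensor_tmul, h_rep]
    rfl
  have h_inner := HilbertTensor.inner_tmul (π.rep a x) (π.rep a x) (ρ.rep 1 k) (ρ.rep 1 k)
  rw [h_tmul, inner_zero_left, eq_comm, mul_eq_zero, inner_self_eq_zero, inner_self_eq_zero]
    at h_inner
  exact h_inner.resolve_right hk

end MinTensor

open Unitary (conjStarAlgAut)

/-- Approximate unitary equivalence of unital `⋆`-homomorphisms, tested on finite subsets. Unlike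
the sequential form, it does not involve any separability. -/
def ApproxUnitarilyEquivalentOnFinsets {A B : Type u} [CStarAlgebra A] [CStarAlgebra B]
    (φ ψ : A →⋆ₐ[ℂ] B) : Prop :=
  ∀ (F : Finset A) (ε : ℝ), 0 < ε →
    ∃ w : unitary B, ∀ a ∈ F, ‖conjStarAlgAut ℂ B w (φ a) - ψ a‖ < ε

theorem ApproxUnitarilyEquivalent.onFinsets {A B : Type u} [CStarAlgebra A] [CStarAlgebra B]
    {φ ψ : A →⋆ₐ[ℂ] B} (h : ApproxUnitarilyEquivalent φ ψ) :
    ApproxUnitarilyEquivalentOnFinsets φ ψ := by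
  obtain ⟨w, hw⟩ := h
  intro F ε hε
  have h_eventually : ∀ᶠ n in atTop, ∀ a ∈ F, ‖conjStarAlgAut ℂ B (w n) (φ a) - ψ a‖ < ε :=
    (Filter.eventually_all_finset F).2 fun a _ => by
      simpa only [dist_eq_norm] using! Metric.tendsto_nhds.1 (hw a) ε hε
  obtain ⟨n, hn⟩ := h_eventually.exists
  exact ⟨w n, hn⟩

namespace ApproxUnitarilyEquivalentOnFinsets

variable {A B C : Type u} [CStarAlgebra A] [CStarAlgebra B] [CStarAlgebra C]

theorem symm {φ ψ : A →⋆ₐ[ℂ] B} (h : ApproxUnitarilyEquivalentOnFinsets φ ψ) :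
    ApproxUnitarilyEquivalentOnFinsets ψ φ := by
  intro F ε hε
  obtain ⟨w, hw⟩ := h F ε hε
  refine ⟨w⁻¹, fun a ha => ?_⟩
  have h_inv : conjStarAlgAut ℂ B w⁻¹ (ψ a) - φ a =
      conjStarAlgAut ℂ B w⁻¹ (ψ a - conjStarAlgAut ℂ B w (φ a)) := by
    rw [map_sub, ← Unitary.conjStarAlgAut_mul_apply, inv_mul_cancel, map_one]
    rfl
  rw [h_inv, StarAlgEquiv.norm_map, norm_sub_rev]
  exact hw a ha

theorem trans {φ ψ χ : A →⋆ₐ[ℂ] B} (h : ApproxUnitarilyEquivalentOnFinsets φ ψ)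
    (h' : ApproxUnitarilyEquivalentOnFinsets ψ χ) :
    ApproxUnitarilyEquivalentOnFinsets φ χ := by
  intro F ε hε
  obtain ⟨w, hw⟩ := h F (ε / 2) (half_pos hε)
  obtain ⟨v, hv⟩ := h' F (ε / 2) (half_pos hε)
  refine ⟨v * w, fun a ha => ?_⟩
  calc ‖conjStarAlgAut ℂ B (v * w) (φ a) - χ a‖
      = ‖conjStarAlgAut ℂ B v (conjStarAlgAut ℂ B w (φ a) - ψ a) +
          (conjStarAlgAut ℂ B v (ψ a) - χ a)‖ := by
        rw [Unitary.conjStarAlgAut_mul_apply, map_sub, sub_add_sub_cancel]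
    _ ≤ ‖conjStarAlgAut ℂ B w (φ a) - ψ a‖ + ‖conjStarAlgAut ℂ B v (ψ a) - χ a‖ :=
        (norm_add_le _ _).trans_eq (by rw [StarAlgEquiv.norm_map])
    _ < ε := by linarith [hw a ha, hv a ha]

theorem comp_left {φ ψ : A →⋆ₐ[ℂ] B} (h : ApproxUnitarilyEquivalentOnFinsets φ ψ)
    (f : B →⋆ₐ[ℂ] C) : ApproxUnitarilyEquivalentOnFinsets (f.comp φ) (f.comp ψ) := by
  intro F ε hε
  obtain ⟨w, hw⟩ := h F ε hε
  refine ⟨⟨f w, Unitary.map_mem f w.2⟩, fun a ha => (le_of_eq_of_le ?_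
    (NonUnitalStarAlgHom.norm_apply_le f _)).trans_lt (hw a ha)⟩
  simp only [Unitary.conjStarAlgAut_apply, StarAlgHom.comp_apply, map_sub, map_mul, map_star]

theorem comp_right {φ ψ : B →⋆ₐ[ℂ] C} (h : ApproxUnitarilyEquivalentOnFinsets φ ψ)
    (f : A →⋆ₐ[ℂ] B) : ApproxUnitarilyEquivalentOnFinsets (φ.comp f) (ψ.comp f) := by
  classical
  intro F ε hε
  obtain ⟨w, hw⟩ := h (F.image f) ε hε
  exact ⟨w, fun a ha => hw (f a) (Finset.mem_image_of_mem f ha)⟩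

end ApproxUnitarilyEquivalentOnFinsets

namespace MinTensor

variable {D : Type u} [CStarAlgebra D]

theorem inl_comp_approxUnitarilyEquivalent_inr_comp {φ : D →⋆ₐ[ℂ] MinTensor D D}
    {s : D →⋆ₐ[ℂ] D} (hφ : ApproxUnitarilyEquivalentOnFinsets (inl D D) φ)
    (hs : φ.comp s = (swap D D).comp φ) (r : D →⋆ₐ[ℂ] D) :
    ApproxUnitarilyEquivalentOnFinsets ((inl D D).comp r) ((inr D D).comp s) := by
  have h_flip : (swap D D).comp ((map (StarAlgHom.id ℂ D) r).comp (swap D D)) =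
      map r (StarAlgHom.id ℂ D) := hom_ext
    (fun a => by simp only [StarAlgHom.comp_apply, swap_inl, map_inr, swap_inr, map_inl])
    (fun d => by simp only [StarAlgHom.comp_apply, swap_inl, map_inr, swap_inr, map_inl])
  have h_inl : (map r (StarAlgHom.id ℂ D)).comp (inl D D) = (inl D D).comp r :=
    StarAlgHom.ext fun d => by rw [StarAlgHom.comp_apply, map_inl, StarAlgHom.comp_apply]
  have h_inr : (swap D D).comp ((map (StarAlgHom.id ℂ D) r).comp (inl D D)) = inr D D :=
    StarAlgHom.ext fun d => by
      rw [StarAlgHom.comp_apply, StarAlgHom.comp_apply, map_inl, swap_inl, StarAlgHom.coe_id,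
        id_eq]
  have h_left := hφ.comp_left (map r (StarAlgHom.id ℂ D))
  have h_right :=
    ((hφ.comp_left (map (StarAlgHom.id ℂ D) r)).comp_left (swap D D)).comp_right s
  rw [h_inl, ← h_flip, StarAlgHom.comp_assoc, StarAlgHom.comp_assoc] at h_left
  rw [h_inr, StarAlgHom.comp_assoc, StarAlgHom.comp_assoc, hs] at h_right
  exact h_left.trans h_right.symm

end MinTensor

theorem IsStronglySelfAbsorbing.inl_approxUnitarilyEquivalent_inr {D : Type u} [CStarAlgebra D]
    (hD : IsStronglySelfAbsorbing D) :
    ApproxUnitarilyEquivalentOnFinsets (MinTensor.inl D D) (MinTensor.inr D D) := by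
  obtain ⟨e, he⟩ := hD.exists_equiv
  let s : D →⋆ₐ[ℂ] D := (e.symm : MinTensor D D →⋆ₐ[ℂ] D).comp
    ((MinTensor.swap D D).comp (e : D →⋆ₐ[ℂ] MinTensor D D))
  have hs : (e : D →⋆ₐ[ℂ] MinTensor D D).comp s = (MinTensor.swap D D).comp e :=
    StarAlgHom.ext fun d => e.apply_symm_apply _
  have h (r : D →⋆ₐ[ℂ] D) := MinTensor.inl_comp_approxUnitarilyEquivalent_inr_comp
    he.onFinsets hs r
  have h_swap_inl : (MinTensor.swap D D).comp (MinTensor.inl D D) = MinTensor.inr D D :=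
    StarAlgHom.ext MinTensor.swap_inl
  have h_swap_inr : (MinTensor.swap D D).comp (MinTensor.inr D D) = MinTensor.inl D D :=
    StarAlgHom.ext MinTensor.swap_inr
  have h_id : ApproxUnitarilyEquivalentOnFinsets (MinTensor.inl D D)
      ((MinTensor.inr D D).comp s) := h (StarAlgHom.id ℂ D)
  have h_id_flip : ApproxUnitarilyEquivalentOnFinsets (MinTensor.inr D D)
      ((MinTensor.inl D D).comp s) := by
    simpa only [← StarAlgHom.comp_assoc, h_swap_inl, h_swap_inr] using
      h_id.comp_left (MinTensor.swap D D)
  exact h_id.trans ((h s).symm.trans h_id_flip.symm)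

section ApproximateIntertwining

variable {B C : Type u} [CStarAlgebra B] [CStarAlgebra C]

theorem norm_conjStarAlgAut_sub_self (w : unitary B) (x : B) :
    ‖conjStarAlgAut ℂ B w x - x‖ = ‖(w : B) * x - x * w‖ := by
  rw [← CStarRing.norm_mul_mem_unitary (conjStarAlgAut ℂ B w x - x) w.2,
    Unitary.conjStarAlgAut_apply, sub_mul, mul_assoc _ (star (w : B)),
    Unitary.star_mul_self_of_mem w.2, mul_one]

theorem cauchySeq_of_dense {X Y : Type*} [PseudoMetricSpace X] [PseudoMetricSpace Y]
    {f : ℕ → X → Y} (hf : ∀ n x y, dist (f n x) (f n y) ≤ dist x y) {s : Set X} (hs : Dense s)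
    (h : ∀ x ∈ s, CauchySeq fun n => f n x) (x : X) : CauchySeq fun n => f n x := by
  refine Metric.cauchySeq_iff'.2 fun ε hε => ?_
  obtain ⟨y, hys, hxy⟩ := hs.exists_dist_lt x (ε := ε / 3) (by positivity)
  obtain ⟨N, hN⟩ := Metric.cauchySeq_iff'.1 (h y hys) (ε / 3) (by positivity)
  refine ⟨N, fun n hn => (dist_triangle4 _ (f n y) (f N y) _).trans_lt ?_⟩
  linarith [hf n x y, hN n hn, hf N y x, dist_comm x y]

theorem cauchySeq_and_dist_le_of_forall_dist_le_geometric {X : Type*} [PseudoMetricSpace X]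
    {a : ℕ → X} {n : ℕ} (h : ∀ k, n ≤ k → dist (a k) (a (k + 1)) ≤ (1 / 2) ^ k) :
    CauchySeq a ∧ ∀ l, Tendsto a atTop (𝓝 l) → dist (a n) l ≤ 2 * (1 / 2) ^ n := by
  have h_shift (k : ℕ) : dist (a (k + n)) (a (k + 1 + n)) ≤ (1 / 2) ^ n * (1 / 2) ^ k := by
    rw [← pow_add, add_comm n, add_right_comm k 1 n]
    exact h _ (Nat.le_add_left n k)
  refine ⟨(cauchySeq_shift n).1 (cauchySeq_of_le_geometric _ _ (by norm_num) h_shift),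
    fun l hl => ?_⟩
  have h_dist := dist_le_of_le_geometric_of_tendsto₀ _ _ (by norm_num) h_shift
    ((tendsto_add_atTop_iff_nat n).2 hl)
  rw [zero_add] at h_dist
  exact h_dist.trans_eq (by ring)

theorem exists_starAlgHom_tendsto {f : ℕ → B →⋆ₐ[ℂ] C} (h : ∀ x, CauchySeq fun n => f n x) :
    ∃ g : B →⋆ₐ[ℂ] C, ∀ x, Tendsto (fun n => f n x) atTop (𝓝 (g x)) := by
  choose g hg using fun x => cauchySeq_tendsto_of_complete (h x)
  have h_unique {x : B} {y : C} (hy : Tendsto (fun n => f n x) atTop (𝓝 y)) : g x = y :=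
    tendsto_nhds_unique (hg x) hy
  exact ⟨{  toFun := g
            map_one' := h_unique (by simp only [map_one, tendsto_const_nhds])
            map_mul' := fun x y => h_unique (by simpa only [map_mul] using (hg x).mul (hg y))
            map_zero' := h_unique (by simp only [map_zero, tendsto_const_nhds])
            map_add' := fun x y => h_unique (by simpa only [map_add] using (hg x).add (hg y))
            commutes' := fun c => h_unique (by
              simp only [AlgHomClass.commutes, tendsto_const_nhds])
            map_star' := fun x => h_unique (by simpa only [map_star] using (hg x).star) }, hg⟩

theorem nonempty_starAlgEquiv_of_tendsto {f : ℕ → B →⋆ₐ[ℂ] C} {g : B →⋆ₐ[ℂ] C}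
    (hf : ∀ n, Function.Injective (f n)) (hg : ∀ x, Tendsto (fun n => f n x) atTop (𝓝 (g x)))
    (h_dense : DenseRange g) : Nonempty (B ≃⋆ₐ[ℂ] C) := by
  have h_isometry : Isometry g := AddMonoidHomClass.isometry_of_norm g fun x =>
    tendsto_nhds_unique (hg x).norm
      (by simp only [NonUnitalStarAlgHom.norm_map (f _) (hf _), tendsto_const_nhds])
  have h_surjective : Function.Surjective g := by
    rw [← Set.range_eq_univ, ← h_isometry.isClosedEmbedding.isClosed_range.closure_eq]
    exact h_dense.closure_range
  exact ⟨StarAlgEquiv.ofBijective g ⟨h_isometry.injective, h_surjective⟩⟩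

theorem nonempty_starAlgEquiv_of_intertwining_sequence {f : ℕ → B →⋆ₐ[ℂ] C}
    {F : ℕ → Finset B} {c : ℕ → C} (hf : ∀ n, Function.Injective (f n)) (hF : Monotone F)
    (hF_dense : Dense (⋃ n, (F n : Set B))) (hc : DenseRange c)
    (h_step : ∀ n, ∀ x ∈ F n, dist (f n x) (f (n + 1) x) ≤ (1 / 2) ^ n)
    (h_approx : ∀ n, ∀ j ≤ n, ∃ x ∈ F (n + 1), dist (c j) (f (n + 1) x) ≤ (1 / 2) ^ n) :
    Nonempty (B ≃⋆ₐ[ℂ] C) := by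
  have h_geometric (n : ℕ) (x : B) (hx : x ∈ F n) :=
    cauchySeq_and_dist_le_of_forall_dist_le_geometric (a := fun k => f k x)
      fun k hk => h_step k x (hF hk hx)
  have h_lipschitz (n : ℕ) (x y : B) : dist (f n x) (f n y) ≤ dist x y :=
    ((NonUnitalStarAlgHom.isometry (f n) (hf n)).dist_eq x y).le
  have h_cauchy_of_mem (x : B) (hx : x ∈ ⋃ n, (F n : Set B)) : CauchySeq fun n => f n x := by
    obtain ⟨n, hn⟩ := Set.mem_iUnion.1 hx
    exact (h_geometric n x hn).1
  obtain ⟨g, hg⟩ := exists_starAlgHom_tendsto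
    (cauchySeq_of_dense h_lipschitz hF_dense h_cauchy_of_mem)
  refine nonempty_starAlgEquiv_of_tendsto hf hg fun z => Metric.mem_closure_iff.2 fun ε hε => ?_
  obtain ⟨j, hj⟩ := hc.exists_dist_lt z (ε := ε / 3) (by positivity)
  obtain ⟨N, hN⟩ := exists_pow_lt_of_lt_one (by positivity : 0 < ε / 3) (one_half_lt_one (α := ℝ))
  obtain ⟨x, hx, hcx⟩ := h_approx (max N j) j (le_max_right N j)
  have h_limit := (h_geometric _ x hx).2 _ (hg x)
  have h_pow : (1 / 2 : ℝ) ^ max N j ≤ (1 / 2) ^ N :=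
    pow_le_pow_of_le_one (by norm_num) (by norm_num) (le_max_left N j)
  rw [pow_succ] at h_limit
  exact ⟨g x, ⟨x, rfl⟩, (dist_triangle4 z (c j) (f _ x) (g x)).trans_lt (by linarith)⟩

/-- A unital `⋆`-homomorphism `f : B → C` is asymptotically absorbing if there are unitaries of `C`
which almost commute with `f(B)` and almost conjugate `C` into `f(B)`; this is the hypothesis of
the one-sided approximate intertwining argument. -/
def IsAsymptoticallyAbsorbing (f : B →⋆ₐ[ℂ] C) : Prop :=
  ∀ (F : Finset B) (S : Finset C) (ε : ℝ), 0 < ε → ∃ v : unitary C,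
    (∀ b ∈ F, ‖conjStarAlgAut ℂ C v (f b) - f b‖ < ε) ∧
      ∀ c ∈ S, ∃ b, ‖c - conjStarAlgAut ℂ C v (f b)‖ < ε

namespace IsAsymptoticallyAbsorbing

theorem exists_step {f : B →⋆ₐ[ℂ] C} (hf : IsAsymptoticallyAbsorbing f) (w : unitary C)
    (F : Finset B) (S : Finset C) {ε : ℝ} (hε : 0 < ε) :
    ∃ (w' : unitary C) (F' : Finset B),
      (∀ b ∈ F, dist (conjStarAlgAut ℂ C w (f b)) (conjStarAlgAut ℂ C w' (f b)) ≤ ε) ∧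
      ∀ c ∈ S, ∃ b ∈ F', dist c (conjStarAlgAut ℂ C w' (f b)) ≤ ε := by
  classical
  obtain ⟨v, hvF, hvS⟩ := hf F (S.image (conjStarAlgAut ℂ C w).symm) ε hε
  choose! b hb using hvS
  have h_isometry := StarAlgEquiv.isometry (conjStarAlgAut ℂ C w)
  refine ⟨w * v, S.image fun c => b ((conjStarAlgAut ℂ C w).symm c), fun x hx => ?_,
    fun c hc => ⟨_, Finset.mem_image_of_mem _ hc, ?_⟩⟩
  · rw [Unitary.conjStarAlgAut_mul_apply, h_isometry.dist_eq, dist_comm, dist_eq_norm]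
    exact (hvF x hx).le
  · have h_symm (y : C) :
        dist c (conjStarAlgAut ℂ C w y) = dist ((conjStarAlgAut ℂ C w).symm c) y := by
      rw [← h_isometry.dist_eq (StarAlgEquiv.symm _ c), StarAlgEquiv.apply_symm_apply]
    rw [Unitary.conjStarAlgAut_mul_apply, h_symm, dist_eq_norm]
    exact (hb _ (Finset.mem_image_of_mem _ hc)).le

theorem exists_sequence {f : B →⋆ₐ[ℂ] C} (hf : IsAsymptoticallyAbsorbing f) (b : ℕ → B)
    (c : ℕ → C) :
    ∃ (w : ℕ → unitary C) (F : ℕ → Finset B), Monotone F ∧ (∀ n, b n ∈ F (n + 1)) ∧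
      (∀ n, ∀ x ∈ F n, dist (conjStarAlgAut ℂ C (w n) (f x))
        (conjStarAlgAut ℂ C (w (n + 1)) (f x)) ≤ (1 / 2) ^ n) ∧
      ∀ n, ∀ j ≤ n, ∃ x ∈ F (n + 1),
        dist (c j) (conjStarAlgAut ℂ C (w (n + 1)) (f x)) ≤ (1 / 2) ^ n := by
  classical
  choose nextUnitary nextFinset h_step h_approx using fun n w F =>
    hf.exists_step w F ((Finset.range (n + 1)).image c) (ε := (1 / 2) ^ n) (by positivity)
  let state : ℕ → unitary C × Finset B := Nat.rec (1, ∅) fun n p =>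
    (nextUnitary n p.1 p.2, insert (b n) (p.2 ∪ nextFinset n p.1 p.2))
  refine ⟨fun n => (state n).1, fun n => (state n).2, monotone_nat_of_le_succ fun n =>
    Finset.subset_union_left.trans (Finset.subset_insert _ _), fun n =>
    Finset.mem_insert_self _ _, fun n => h_step n _ _, fun n j hj => ?_⟩
  obtain ⟨x, hx, hxc⟩ := h_approx n (state n).1 (state n).2 (c j)
    (Finset.mem_image_of_mem c (Finset.mem_range_succ_iff.2 hj))
  exact ⟨x, Finset.mem_insert_of_mem (Finset.mem_union_right _ hx), hxc⟩

theorem nonempty_starAlgEquiv [TopologicalSpace.SeparableSpace B]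
    [TopologicalSpace.SeparableSpace C] {f : B →⋆ₐ[ℂ] C} (hf : IsAsymptoticallyAbsorbing f)
    (hf_injective : Function.Injective f) : Nonempty (B ≃⋆ₐ[ℂ] C) := by
  obtain ⟨w, F, hF, hbF, h_step, h_approx⟩ :=
    hf.exists_sequence (TopologicalSpace.denseSeq B) (TopologicalSpace.denseSeq C)
  have hF_dense : Dense (⋃ n, (F n : Set B)) :=
    (TopologicalSpace.denseRange_denseSeq B).mono <| Set.range_subset_iff.2 fun n =>
      Set.mem_iUnion.2 ⟨n + 1, hbF n⟩
  exact nonempty_starAlgEquiv_of_intertwining_sequence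
    (f := fun n => (conjStarAlgAut ℂ C (w n) : C →⋆ₐ[ℂ] C).comp f)
    (fun n => (conjStarAlgAut ℂ C (w n)).injective.comp hf_injective) hF hF_dense
    (TopologicalSpace.denseRange_denseSeq C) h_step h_approx

end IsAsymptoticallyAbsorbing

end ApproximateIntertwining

section AsymptoticCommutation

variable {ι : Type*} {l : Filter ι} {B E : Type*} [CStarAlgebra B] [CStarAlgebra E]

theorem isBoundedUnder_norm_map (f : ι → B →⋆ₐ[ℂ] E) (b : B) :
    IsBoundedUnder (· ≤ ·) l (norm ∘ fun i => f i b) :=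
  isBoundedUnder_of ⟨‖b‖, fun i => NonUnitalStarAlgHom.norm_apply_le (f i) b⟩

/-- The elements of `B` whose images under the homomorphisms `f i` commute asymptotically with the
elements `v i`. -/
def asymptoticCommutant (l : Filter ι) (f : ι → B →⋆ₐ[ℂ] E) (v : ι → E) : Subalgebra ℂ B where
  carrier := {b | Tendsto (fun i => v i * f i b - f i b * v i) l (𝓝 0)}
  mul_mem' {b c} hb hc := by
    have h_sum := (hb.zero_mul_isBoundedUnder_le (isBoundedUnder_norm_map f c)).add
      (isBoundedUnder_le_mul_tendsto_zero (isBoundedUnder_norm_map f b) hc)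
    rw [add_zero] at h_sum
    refine h_sum.congr fun i => ?_
    rw [map_mul]
    noncomm_ring
  add_mem' {b c} hb hc := by
    have h_sum := hb.add hc
    rw [add_zero] at h_sum
    refine h_sum.congr fun i => ?_
    rw [map_add]
    noncomm_ring
  algebraMap_mem' z := by
    simp only [AlgHomClass.commutes, Algebra.commutes, sub_self, Set.mem_ofPred_eq,
      tendsto_const_nhds]

theorem mem_asymptoticCommutant {f : ι → B →⋆ₐ[ℂ] E} {v : ι → E} {b : B} :
    b ∈ asymptoticCommutant l f v ↔ Tendsto (fun i => v i * f i b - f i b * v i) l (𝓝 0) :=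
  Iff.rfl

/-- A net of homomorphisms of `B` into `E` whose values asymptotically commute with every
element of `E`. -/
def IsAsymptoticallyCentral (l : Filter ι) (f : ι → B →⋆ₐ[ℂ] E) : Prop :=
  ∀ b x, Tendsto (fun i => f i b * x - x * f i b) l (𝓝 0)

theorem uniformEquicontinuous_commutator (f : ι → B →⋆ₐ[ℂ] E) {v : ι → E} {M : ℝ}
    (hv : ∀ i, ‖v i‖ ≤ M) : UniformEquicontinuous fun i b => v i * f i b - f i b * v i := by
  refine LipschitzWith.uniformEquicontinuous _ (2 * M).toNNReal fun i =>
    LipschitzWith.of_dist_le' fun b c => ?_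
  have h_split : v i * f i b - f i b * v i - (v i * f i c - f i c * v i) =
      v i * f i (b - c) - f i (b - c) * v i := by
    rw [map_sub]
    noncomm_ring
  have h_norm := NonUnitalStarAlgHom.norm_apply_le (f i) (b - c)
  rw [dist_eq_norm, dist_eq_norm, h_split]
  calc ‖v i * f i (b - c) - f i (b - c) * v i‖
      ≤ ‖v i‖ * ‖f i (b - c)‖ + ‖f i (b - c)‖ * ‖v i‖ :=
        (norm_sub_le _ _).trans (add_le_add (norm_mul_le _ _) (norm_mul_le _ _))
    _ = 2 * (‖v i‖ * ‖f i (b - c)‖) := by ring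
    _ ≤ 2 * (M * ‖b - c‖) := mul_le_mul_of_nonneg_left (mul_le_mul (hv i) h_norm
        (norm_nonneg _) ((norm_nonneg _).trans (hv i))) zero_le_two
    _ = 2 * M * ‖b - c‖ := by ring

theorem isClosed_asymptoticCommutant {f : ι → B →⋆ₐ[ℂ] E} {v : ι → E} {M : ℝ}
    (hv : ∀ i, ‖v i‖ ≤ M) : IsClosed (asymptoticCommutant l f v : Set B) :=
  (uniformEquicontinuous_commutator f hv).equicontinuous.isClosed_setOfPred_tendsto
    continuous_const

/-- The elements of `B` at which the nets of homomorphisms `f` and `g` are asymptotically equal. -/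
def asymptoticEqualizer (l : Filter ι) (f g : ι → B →⋆ₐ[ℂ] E) : Subalgebra ℂ B where
  carrier := {b | Tendsto (fun i => f i b - g i b) l (𝓝 0)}
  mul_mem' {b c} hb hc := by
    have h_sum := (hb.zero_mul_isBoundedUnder_le (isBoundedUnder_norm_map f c)).add
      (isBoundedUnder_le_mul_tendsto_zero (isBoundedUnder_norm_map g b) hc)
    rw [add_zero] at h_sum
    refine h_sum.congr fun i => ?_
    rw [map_mul, map_mul]
    noncomm_ring
  add_mem' {b c} hb hc := by
    have h_sum := hb.add hc
    rw [add_zero] at h_sum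
    refine h_sum.congr fun i => ?_
    rw [map_add, map_add, add_sub_add_comm]
  algebraMap_mem' z := by
    simp only [AlgHomClass.commutes, sub_self, Set.mem_ofPred_eq, tendsto_const_nhds]

theorem mem_asymptoticEqualizer {f g : ι → B →⋆ₐ[ℂ] E} {b : B} :
    b ∈ asymptoticEqualizer l f g ↔ Tendsto (fun i => f i b - g i b) l (𝓝 0) :=
  Iff.rfl

theorem isClosed_asymptoticEqualizer (f g : ι → B →⋆ₐ[ℂ] E) :
    IsClosed (asymptoticEqualizer l f g : Set B) := by
  have h_equicontinuous : UniformEquicontinuous fun i b => f i b - g i b := by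
    refine LipschitzWith.uniformEquicontinuous _ 2 fun i => LipschitzWith.of_dist_le_mul
      fun b c => ?_
    rw [dist_eq_norm, dist_eq_norm, sub_sub_sub_comm, ← map_sub, ← map_sub, NNReal.coe_ofNat,
      two_mul]
    exact (norm_sub_le _ _).trans (add_le_add (NonUnitalStarAlgHom.norm_apply_le _ _)
      (NonUnitalStarAlgHom.norm_apply_le _ _))
  exact h_equicontinuous.equicontinuous.isClosed_setOfPred_tendsto continuous_const

/-- The elements of `B` whose images under the homomorphisms `f i` approach the subalgebra `S`. -/
def asymptoticPreimage (l : Filter ι) (f : ι → B →⋆ₐ[ℂ] E) (S : Subalgebra ℂ E) :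
    Subalgebra ℂ B where
  carrier := {b | ∀ ε > 0, ∀ᶠ i in l, ∃ y ∈ S, ‖f i b - y‖ < ε}
  mul_mem' {b c} hb hc ε hε := by
    filter_upwards [hb (min 1 (ε / 2 / (‖c‖ + 1))) (by positivity),
      hc (ε / 2 / (‖b‖ + 1)) (by positivity)] with i ⟨y, hy, hby⟩ ⟨z, hz, hcz⟩
    refine ⟨y * z, mul_mem hy hz, ?_⟩
    obtain ⟨hby_one, hby⟩ := lt_min_iff.1 hby
    have hb_norm := NonUnitalStarAlgHom.norm_apply_le (f i) b
    have hc_norm := NonUnitalStarAlgHom.norm_apply_le (f i) c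
    have hy_norm : ‖y‖ ≤ ‖b‖ + 1 := by linarith [norm_sub_norm_le y (f i b), norm_sub_rev y (f i b)]
    rw [lt_div_iff₀ (by positivity)] at hby hcz
    calc ‖f i (b * c) - y * z‖ = ‖(f i b - y) * f i c + y * (f i c - z)‖ := by
          rw [map_mul]; congr 1; noncomm_ring
      _ ≤ ‖f i b - y‖ * ‖f i c‖ + ‖y‖ * ‖f i c - z‖ :=
        (norm_add_le _ _).trans (add_le_add (norm_mul_le _ _) (norm_mul_le _ _))
      _ ≤ ‖f i b - y‖ * (‖c‖ + 1) + (‖b‖ + 1) * ‖f i c - z‖ := by gcongr; linarith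
      _ < ε := by linarith
  add_mem' {b c} hb hc ε hε := by
    filter_upwards [hb (ε / 2) (half_pos hε), hc (ε / 2) (half_pos hε)]
      with i ⟨y, hy, hby⟩ ⟨z, hz, hcz⟩
    refine ⟨y + z, add_mem hy hz, ?_⟩
    rw [map_add, add_sub_add_comm]
    linarith [norm_add_le (f i b - y) (f i c - z)]
  algebraMap_mem' z ε hε := Eventually.of_forall fun i =>
    ⟨algebraMap ℂ E z, S.algebraMap_mem z, by rwa [AlgHomClass.commutes, sub_self, norm_zero]⟩

theorem isClosed_asymptoticPreimage (f : ι → B →⋆ₐ[ℂ] E) (S : Subalgebra ℂ E) :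
    IsClosed (asymptoticPreimage l f S : Set B) := by
  refine isClosed_of_closure_subset fun b hb ε hε => ?_
  obtain ⟨c, hc, hbc⟩ := Metric.mem_closure_iff.1 hb (ε / 2) (half_pos hε)
  rw [dist_eq_norm] at hbc
  filter_upwards [hc (ε / 2) (half_pos hε)] with i ⟨y, hy, hcy⟩
  refine ⟨y, hy, ?_⟩
  have h_norm := NonUnitalStarAlgHom.norm_apply_le (f i) (b - c)
  rw [map_sub] at h_norm
  linarith [norm_sub_le_norm_sub_add_norm_sub (f i b) (f i c) y]

end AsymptoticCommutation

section SquarePartitions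

variable {E : Type*} [CStarAlgebra E]

section OperatorOrder

attribute [local instance] CStarAlgebra.spectralOrder CStarAlgebra.spectralOrderedRing

theorem star_sum_conj_mul_self_le {κ : Type*} (s : Finset κ) {h : κ → E} (a : κ → E)
    (h_selfAdjoint : ∀ k, IsSelfAdjoint (h k)) (h_sum : ∑ k ∈ s, h k * h k = 1) :
    star (∑ k ∈ s, h k * a k * h k) * ∑ k ∈ s, h k * a k * h k ≤
      ∑ k ∈ s, h k * (star (a k) * a k) * h k := by
  set x := ∑ k ∈ s, h k * a k * h k with hx
  have h_star : star x = ∑ k ∈ s, h k * star (a k) * h k := by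
    simp only [hx, star_sum, star_mul, (h_selfAdjoint _).star_eq, mul_assoc]
  have h_expand : ∑ k ∈ s, star (a k * h k - h k * x) * (a k * h k - h k * x) =
      ∑ k ∈ s, h k * (star (a k) * a k) * h k - star x * x := by
    calc ∑ k ∈ s, star (a k * h k - h k * x) * (a k * h k - h k * x)
        = ∑ k ∈ s, (h k * (star (a k) * a k) * h k - h k * star (a k) * h k * x
          - star x * (h k * a k * h k) + star x * (h k * h k) * x) := by
          refine Finset.sum_congr rfl fun k _ => ?_
          simp only [star_sub, star_mul, (h_selfAdjoint k).star_eq]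
          noncomm_ring
      _ = ∑ k ∈ s, h k * (star (a k) * a k) * h k - star x * x := by
          rw [Finset.sum_add_distrib, Finset.sum_sub_distrib, Finset.sum_sub_distrib,
            ← Finset.sum_mul, ← Finset.sum_mul, ← Finset.mul_sum, ← Finset.mul_sum, h_sum,
            ← h_star, ← hx]
          noncomm_ring
  rw [← sub_nonneg, ← h_expand]
  exact Finset.sum_nonneg fun k _ => star_mul_self_nonneg _

theorem norm_sum_conj_le {κ : Type*} (s : Finset κ) {h a : κ → E} {M : ℝ} (hM : 0 ≤ M)
    (h_selfAdjoint : ∀ k, IsSelfAdjoint (h k)) (h_sum : ∑ k ∈ s, h k * h k = 1)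
    (ha : ∀ k, ‖a k‖ ≤ M) : ‖∑ k ∈ s, h k * a k * h k‖ ≤ M := by
  set x := ∑ k ∈ s, h k * a k * h k
  have h_term (k : κ) : h k * (star (a k) * a k) * h k ≤ M ^ 2 • (h k * h k) := by
    have h_le : star (a k) * a k ≤ algebraMap ℝ E (M ^ 2) :=
      CStarAlgebra.star_mul_le_algebraMap_norm_sq.trans
        (algebraMap_mono E (pow_le_pow_left₀ (norm_nonneg _) (ha k) 2))
    have h_conj := star_left_conjugate_le_conjugate h_le (h k)
    rwa [(h_selfAdjoint k).star_eq, ← Algebra.commutes, mul_assoc (algebraMap ℝ E _),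
      ← Algebra.smul_def] at h_conj
  have h_le : star x * x ≤ algebraMap ℝ E (M ^ 2) :=
    (star_sum_conj_mul_self_le s a h_selfAdjoint h_sum).trans <|
      (Finset.sum_le_sum fun k _ => h_term k).trans_eq <| by
        rw [← Finset.smul_sum, h_sum, Algebra.algebraMap_eq_smul_one]
  refine abs_le_of_sq_le_sq' ?_ hM |>.2
  rw [sq, ← CStarRing.norm_star_mul_self]
  exact (CStarAlgebra.norm_le_iff_le_algebraMap _ (sq_nonneg M) (star_mul_self_nonneg x)).2 h_le

end OperatorOrder

variable {X : Type*} [TopologicalSpace X]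

theorem norm_sub_sum_smul_le {V : Type*} [NormedAddCommGroup V] [NormedSpace ℂ V]
    {s : Finset X} {r : X → C(X, ℂ)} (h_selfAdjoint : ∀ k, IsSelfAdjoint (r k))
    (h_sum : ∑ k ∈ s, r k * r k = 1) (f : C(X, V)) {ε : ℝ}
    (hf : ∀ k x, r k x ≠ 0 → dist (f x) (f k) < ε) (x : X) :
    ‖f x - ∑ k ∈ s, (r k * r k) x • f k‖ ≤ ε := by
  have h_sum_apply : ∑ k ∈ s, r k x * r k x = 1 := by
    simpa only [ContinuousMap.sum_apply, ContinuousMap.mul_apply, ContinuousMap.one_apply]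
      using DFunLike.congr_fun h_sum x
  have h_real (k : X) : ((‖r k x‖ ^ 2 : ℝ) : ℂ) = r k x * r k x := by
    rw [Complex.ofReal_pow, ← Complex.conj_mul']
    exact congrArg (· * r k x) (DFunLike.congr_fun (h_selfAdjoint k).star_eq x)
  have h_norm_sum : ∑ k ∈ s, ‖r k x‖ ^ 2 = 1 := by
    exact_mod_cast (Finset.sum_congr rfl fun k _ => h_real k).trans h_sum_apply
  calc ‖f x - ∑ k ∈ s, (r k * r k) x • f k‖
      = ‖∑ k ∈ s, (r k x * r k x) • (f x - f k)‖ := by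
        simp only [ContinuousMap.mul_apply, smul_sub, Finset.sum_sub_distrib, ← Finset.sum_smul,
          h_sum_apply, one_smul]
    _ ≤ ∑ k ∈ s, ‖r k x‖ ^ 2 * ε := norm_sum_le_of_le s fun k _ => by
        rw [norm_smul, norm_mul, ← sq]
        by_cases hk : r k x = 0
        · simp only [hk, norm_zero, ne_eq, OfNat.ofNat_ne_zero, not_false_eq_true, zero_pow,
            zero_mul, le_refl]
        · rw [← dist_eq_norm]
          gcongr
          exact (hf k x hk).le
    _ = ε := by rw [← Finset.sum_mul, h_norm_sum, one_mul]

variable [CompactSpace X] [T2Space X]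

theorem exists_square_partition {Y : Type*} [PseudoMetricSpace Y] (f : C(X, Y)) {ε : ℝ}
    (hε : 0 < ε) : ∃ (s : Finset X) (r : X → C(X, ℂ)), (∀ k, IsSelfAdjoint (r k)) ∧
      ∑ k ∈ s, r k * r k = 1 ∧ ∀ k x, r k x ≠ 0 → dist (f x) (f k) < ε := by
  obtain ⟨ρ, hρ⟩ := PartitionOfUnity.exists_isSubordinate isClosed_univ
    (fun k => {x | dist (f x) (f k) < ε})
    (fun k => isOpen_lt (by fun_prop) continuous_const)
    (fun x _ => Set.mem_iUnion.2 ⟨x, by simpa using hε⟩)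
  have h_finite := ρ.locallyFinite.finite_nonempty_of_compact
  let r (k : X) : C(X, ℂ) := ⟨fun x => (√(ρ k x) : ℝ), by fun_prop⟩
  have hr_sq (k x : X) : r k x * r k x = (ρ k x : ℝ) := by
    simp only [r, ContinuousMap.coe_mk, ← Complex.ofReal_mul, Real.mul_self_sqrt (ρ.nonneg k x)]
  refine ⟨h_finite.toFinset, r, fun k => ?_, ?_, fun k x hx => ?_⟩
  · ext x
    exact Complex.conj_ofReal _
  · ext x
    have h_support : (fun k => ρ k x).support ⊆ h_finite.toFinset := fun k hk => by
      rw [Set.Finite.coe_toFinset]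
      exact ⟨x, hk⟩
    simp only [ContinuousMap.sum_apply, ContinuousMap.mul_apply, hr_sq, ContinuousMap.one_apply]
    rw [← Complex.ofReal_sum, ← finsum_eq_sum_of_support_subset _ h_support,
      ρ.sum_eq_one (Set.mem_univ x), Complex.ofReal_one]
  · refine hρ k (subset_tsupport _ fun h_zero => hx ?_)
    simp only [r, ContinuousMap.coe_mk, h_zero, Real.sqrt_zero, Complex.ofReal_zero]

end SquarePartitions

section AsymptoticSymbols

variable {X : Type*} [TopologicalSpace X] {E : Type*} [CStarAlgebra E]

/-- The homomorphism `C(X, ℂ) ⊗ E → C(X, E)` sending `φ ⊗ a` to `x ↦ φ x • a`. -/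
noncomputable def symbol : C(X, ℂ) ⊗[ℂ] E →ₐ[ℂ] C(X, E) :=
  Algebra.TensorProduct.lift
    ((Algebra.ofId ℂ E).compLeftContinuous ℂ (algebraMapCLM ℂ E).continuous)
    { toFun := ContinuousMap.const X
      map_one' := rfl
      map_mul' _ _ := rfl
      map_zero' := rfl
      map_add' _ _ := rfl
      commutes' _ := rfl }
    fun φ _ => ContinuousMap.ext fun x => Algebra.commutes (φ x) _

theorem symbol_tmul_apply (φ : C(X, ℂ)) (a : E) (x : X) : symbol (φ ⊗ₜ[ℂ] a) x = φ x • a :=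
  (Algebra.smul_def (φ x) a).symm

theorem symbol_sum_apply {κ : Type*} (s : Finset κ) (φ : κ → C(X, ℂ)) (a : κ → E) (x : X) :
    symbol (∑ k ∈ s, φ k ⊗ₜ[ℂ] a k) x = ∑ k ∈ s, φ k x • a k := by
  simp only [map_sum, ContinuousMap.sum_apply, symbol_tmul_apply]

theorem symbol_star (z : C(X, ℂ) ⊗[ℂ] E) :
    symbol (star z) = star (symbol z) := by
  induction z with
  | zero => simp only [star_zero, map_zero]
  | tmul φ a =>
    ext x
    simp only [TensorProduct.star_tmul, symbol_tmul_apply, ContinuousMap.star_apply, star_smul]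
  | add z w hz hw => simp only [star_add, map_add, hz, hw]

/-- The linear map `C(X, ℂ) ⊗ E → E` sending `φ ⊗ a` to `f φ * a`. It is a homomorphism when the
range of `f` is central. -/
noncomputable def evalSymbol (f : C(X, ℂ) →⋆ₐ[ℂ] E) : C(X, ℂ) ⊗[ℂ] E →ₗ[ℂ] E :=
  TensorProduct.lift ((LinearMap.mul ℂ E).comp f.toAlgHom.toLinearMap)

theorem evalSymbol_tmul (f : C(X, ℂ) →⋆ₐ[ℂ] E) (φ : C(X, ℂ)) (a : E) :
    evalSymbol f (φ ⊗ₜ[ℂ] a) = f φ * a :=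
  rfl

theorem evalSymbol_sum (f : C(X, ℂ) →⋆ₐ[ℂ] E) {κ : Type*} (s : Finset κ) (φ : κ → C(X, ℂ))
    (a : κ → E) : evalSymbol f (∑ k ∈ s, φ k ⊗ₜ[ℂ] a k) = ∑ k ∈ s, f (φ k) * a k := by
  simp only [map_sum, evalSymbol_tmul]

variable {ι : Type*} {l : Filter ι}

variable [CompactSpace X] {f : ι → C(X, ℂ) →⋆ₐ[ℂ] E}

theorem IsAsymptoticallyCentral.tendsto_evalSymbol_mul (hf : IsAsymptoticallyCentral l f)
    (z w : C(X, ℂ) ⊗[ℂ] E) :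
    Tendsto (fun i => evalSymbol (f i) (z * w) - evalSymbol (f i) z * evalSymbol (f i) w)
      l (𝓝 0) := by
  induction z with
  | zero => simp only [zero_mul, map_zero, sub_self, tendsto_const_nhds]
  | add z₁ z₂ h₁ h₂ =>
    refine ((h₁.add h₂).congr fun i => ?_).trans_eq (by rw [add_zero])
    rw [add_mul, map_add, map_add, add_mul, add_sub_add_comm]
  | tmul φ a =>
    induction w with
    | zero => simp only [mul_zero, map_zero, sub_self, tendsto_const_nhds]
    | add w₁ w₂ h₁ h₂ =>
      refine ((h₁.add h₂).congr fun i => ?_).trans_eq (by rw [add_zero])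
      rw [mul_add, map_add, map_add, mul_add, add_sub_add_comm]
    | tmul ψ b =>
      have h := ((isBoundedUnder_le_mul_tendsto_zero (isBoundedUnder_norm_map f φ) (hf ψ a)).mul
        (tendsto_const_nhds (x := b)))
      rw [zero_mul] at h
      refine h.congr fun i => ?_
      rw [Algebra.TensorProduct.tmul_mul_tmul, evalSymbol_tmul, evalSymbol_tmul, evalSymbol_tmul,
        map_mul]
      noncomm_ring

theorem IsAsymptoticallyCentral.tendsto_evalSymbol_star (hf : IsAsymptoticallyCentral l f)
    (z : C(X, ℂ) ⊗[ℂ] E) :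
    Tendsto (fun i => evalSymbol (f i) (star z) - star (evalSymbol (f i) z)) l (𝓝 0) := by
  induction z with
  | zero => simp only [star_zero, map_zero, sub_self, tendsto_const_nhds]
  | add z₁ z₂ h₁ h₂ =>
    refine ((h₁.add h₂).congr fun i => ?_).trans_eq (by rw [add_zero])
    rw [star_add, map_add, map_add, star_add, add_sub_add_comm]
  | tmul φ a =>
    refine (hf (star φ) (star a)).congr fun i => ?_
    rw [TensorProduct.star_tmul, evalSymbol_tmul, evalSymbol_tmul, star_mul, map_star]

variable [T2Space X]

theorem exists_norm_symbol_sub_le (g : C(X, E)) {ε : ℝ} (hε : 0 < ε) :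
    ∃ z, ‖symbol z - g‖ ≤ ε ∧ ∀ (f : C(X, ℂ) →⋆ₐ[ℂ] E) (S : Subalgebra ℂ E),
      (∀ φ, f φ ∈ S) → (∀ x, g x ∈ S) → evalSymbol f z ∈ S := by
  obtain ⟨s, r, hr, hr_sum, hr_dist⟩ := exists_square_partition g hε
  refine ⟨∑ k ∈ s, (r k * r k) ⊗ₜ[ℂ] g k, (ContinuousMap.norm_le _ hε.le).2 fun x => ?_,
    fun f S hf hg => ?_⟩
  · rw [ContinuousMap.sub_apply, symbol_sum_apply, norm_sub_rev]
    exact norm_sub_sum_smul_le hr hr_sum g hr_dist x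
  · rw [evalSymbol_sum]
    exact sum_mem fun k _ => mul_mem (hf _) (hg k)

theorem exists_square_partition_evalSymbol_near (z : C(X, ℂ) ⊗[ℂ] E) {ε : ℝ} (hε : 0 < ε) :
    ∃ (s : Finset X) (r : X → C(X, ℂ)), (∀ k, IsSelfAdjoint (r k)) ∧ ∑ k ∈ s, r k * r k = 1 ∧
      ∀ g : C(X, ℂ) →⋆ₐ[ℂ] E,
        ‖evalSymbol g (z - ∑ k ∈ s, (r k * r k) ⊗ₜ[ℂ] symbol z k)‖ ≤ ε := by
  obtain ⟨S, rfl⟩ := TensorProduct.exists_finset z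
  obtain ⟨δ, hδ, hδε⟩ : ∃ δ > 0, δ * ∑ p ∈ S, ‖p.2‖ ≤ ε := by
    have : 0 ≤ ∑ p ∈ S, ‖p.2‖ := Finset.sum_nonneg fun p _ => norm_nonneg _
    refine ⟨ε / (∑ p ∈ S, ‖p.2‖ + 1), by positivity, ?_⟩
    rw [div_mul_eq_mul_div, div_le_iff₀ (by positivity)]
    linarith
  obtain ⟨s, r, hr, hr_sum, hr_dist⟩ :=
    exists_square_partition (⟨fun x (p : S) => p.1.1 x, by fun_prop⟩ : C(X, S → ℂ)) hδ
  refine ⟨s, r, hr, hr_sum, fun g => ?_⟩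
  have h_coeff (p : C(X, ℂ) × E) (hp : p ∈ S) :
      ‖p.1 - ∑ k ∈ s, p.1 k • (r k * r k)‖ ≤ δ := by
    refine (ContinuousMap.norm_le _ hδ.le).2 fun x => ?_
    have h := norm_sub_sum_smul_le hr hr_sum p.1
      (fun k x hx => (dist_le_pi_dist _ _ (⟨p, hp⟩ : S)).trans_lt (hr_dist k x hx)) x
    simpa only [ContinuousMap.sub_apply, ContinuousMap.sum_apply, ContinuousMap.smul_apply,
      smul_eq_mul, mul_comm] using h
  have h_split : ∑ p ∈ S, p.1 ⊗ₜ[ℂ] p.2 -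
      ∑ k ∈ s, (r k * r k) ⊗ₜ[ℂ] symbol (∑ p ∈ S, p.1 ⊗ₜ[ℂ] p.2) k =
      ∑ p ∈ S, (p.1 - ∑ k ∈ s, p.1 k • (r k * r k)) ⊗ₜ[ℂ] p.2 := by
    simp only [symbol_sum_apply, TensorProduct.tmul_sum, TensorProduct.sub_tmul,
      TensorProduct.sum_tmul, TensorProduct.tmul_smul, TensorProduct.smul_tmul',
      Finset.sum_sub_distrib]
    rw [Finset.sum_comm]
  rw [h_split, evalSymbol_sum]
  refine le_trans ?_ hδε
  rw [Finset.mul_sum]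
  refine norm_sum_le_of_le S fun p hp => (norm_mul_le _ _).trans ?_
  gcongr
  exact (NonUnitalStarAlgHom.norm_apply_le g _).trans (h_coeff p hp)

theorem IsAsymptoticallyCentral.eventually_norm_evalSymbol_lt (hf : IsAsymptoticallyCentral l f)
    {z : C(X, ℂ) ⊗[ℂ] E} {M : ℝ} (hz : ‖symbol z‖ < M) :
    ∀ᶠ i in l, ‖evalSymbol (f i) z‖ < M := by
  obtain ⟨ε, hε, hεM⟩ : ∃ ε > 0, ‖symbol z‖ + 2 * ε = M := ⟨(M - ‖symbol z‖) / 2, by linarith,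
    by ring⟩
  obtain ⟨s, r, hr, hr_sum, h_near⟩ := exists_square_partition_evalSymbol_near z hε
  set z' := ∑ k ∈ s, (r k * r k) ⊗ₜ[ℂ] symbol z k
  have h_conj (i : ι) : ‖∑ k ∈ s, f i (r k) * symbol z k * f i (r k)‖ ≤ ‖symbol z‖ :=
    norm_sum_conj_le s (norm_nonneg _) (fun k => (hr k).map (f i))
      (by simp only [← map_mul, ← map_sum, hr_sum, map_one])
      fun k => ContinuousMap.norm_coe_le_norm _ k
  have h_tendsto : Tendsto (fun i => evalSymbol (f i) z' -
      ∑ k ∈ s, f i (r k) * symbol z k * f i (r k)) l (𝓝 0) := by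
    have h := tendsto_finsetSum s fun k _ =>
      isBoundedUnder_le_mul_tendsto_zero (isBoundedUnder_norm_map f (r k)) (hf (r k) (symbol z k))
    rw [Finset.sum_const_zero] at h
    refine h.congr fun i => ?_
    rw [evalSymbol_sum, ← Finset.sum_sub_distrib]
    refine Finset.sum_congr rfl fun k _ => ?_
    rw [map_mul]
    noncomm_ring
  filter_upwards [(tendsto_zero_iff_norm_tendsto_zero.1 h_tendsto).eventually_lt_const hε]
    with i hi
  have h_near_i := h_near (f i)
  rw [map_sub] at h_near_i
  linarith [h_conj i, norm_sub_norm_le (evalSymbol (f i) z) (evalSymbol (f i) z'),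
    norm_sub_norm_le (evalSymbol (f i) z') (∑ k ∈ s, f i (r k) * symbol z k * f i (r k))]

theorem denseRange_symbol : DenseRange (symbol : C(X, ℂ) ⊗[ℂ] E → C(X, E)) := by
  refine Metric.dense_iff.2 fun g ε hε => ?_
  obtain ⟨z, hz, -⟩ := exists_norm_symbol_sub_le g (half_pos hε)
  exact ⟨_, mem_ball_iff_norm.2 (hz.trans_lt (half_lt_self hε)), z, rfl⟩

end AsymptoticSymbols

section Polar

attribute [local instance] CStarAlgebra.spectralOrder CStarAlgebra.spectralOrderedRing

variable {E : Type*} [CStarAlgebra E]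

theorem norm_one_sub_sqrt_le {a : E} (ha : 0 ≤ a) : ‖1 - CFC.sqrt a‖ ≤ ‖1 - a‖ := by
  nontriviality E
  have h_cfc : 1 - CFC.sqrt a = cfc (fun t : ℝ => 1 - √t) a := by
    rw [cfc_sub _ _ a, cfc_const_one ℝ a, CFC.sqrt_eq_real_sqrt a, cfcₙ_eq_cfc]
  rw [h_cfc]
  refine norm_cfc_le (norm_nonneg _) fun t ht => ?_
  have ht_nonneg : 0 ≤ t := spectrum_nonneg_of_nonneg ha ht
  have ht_sub : 1 - t ∈ spectrum ℝ (1 - a) := by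
    rw [← map_one (algebraMap ℝ E), ← spectrum.singleton_sub_eq]
    exact Set.sub_mem_sub rfl ht
  calc ‖1 - √t‖ ≤ ‖1 - √t‖ * (1 + √t) :=
        le_mul_of_one_le_right (norm_nonneg _) (by linarith [Real.sqrt_nonneg t])
    _ = ‖(1 - √t) * (1 + √t)‖ := by
        rw [norm_mul, Real.norm_of_nonneg (r := 1 + √t) (by positivity)]
    _ = ‖1 - t‖ := by
        congr 1
        linear_combination -Real.mul_self_sqrt ht_nonneg
    _ ≤ ‖1 - a‖ := spectrum.norm_le_norm_of_mem ht_sub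

theorem isUnit_of_norm_one_sub_lt_one {a : E} (ha : ‖1 - a‖ < 1) : IsUnit a := by
  simpa only [sub_sub_cancel] using isUnit_one_sub_of_norm_lt_one ha

theorem isUnit_of_isUnit_star_mul_self {x : E} (h_left : IsUnit (star x * x))
    (h_right : IsUnit (x * star x)) : IsUnit x := by
  obtain ⟨b, hb⟩ := h_right.exists_right_inv
  obtain ⟨c, hc⟩ := h_left.exists_left_inv
  exact isUnit_iff_exists_and_exists.2
    ⟨⟨star x * b, by rw [← mul_assoc, hb]⟩, ⟨c * star x, by rw [mul_assoc, hc]⟩⟩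

theorem exists_unitary_norm_sub_le {x : E} {η : ℝ} (hη : η < 1) (h_left : ‖star x * x - 1‖ ≤ η)
    (h_right : ‖x * star x - 1‖ ≤ η) : ∃ w : unitary E, ‖(w : E) - x‖ ≤ η := by
  rw [norm_sub_rev] at h_left h_right
  have h_nonneg : 0 ≤ star x * x := star_mul_self_nonneg x
  have h_isUnit : IsUnit (star x * x) := isUnit_of_norm_one_sub_lt_one (h_left.trans_lt hη)
  have hx : IsUnit x := isUnit_of_isUnit_star_mul_self h_isUnit
    (isUnit_of_norm_one_sub_lt_one (h_right.trans_lt hη))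
  obtain ⟨s, hs⟩ := (CFC.isUnit_sqrt_iff (star x * x) h_nonneg).2 h_isUnit
  have hs_sq : (s : E) * s = star x * x := by rw [hs, CFC.sqrt_mul_sqrt_self _ h_nonneg]
  have hs_star : star s = s := Units.ext <| by
    rw [Units.coe_star, hs, (IsSelfAdjoint.of_nonneg (CFC.sqrt_nonneg _)).star_eq]
  have hs_inv : star (↑s⁻¹ : E) = ↑s⁻¹ := by rw [← Units.coe_star, star_inv, hs_star]
  have hw : x * ↑s⁻¹ ∈ unitary E := by
    refine (hx.mul s⁻¹.isUnit).mem_unitary_of_star_mul_self ?_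
    rw [star_mul, hs_inv, mul_assoc, ← mul_assoc (star x), ← hs_sq, mul_assoc, Units.mul_inv,
      mul_one, Units.inv_mul]
  refine ⟨⟨x * ↑s⁻¹, hw⟩, ?_⟩
  have h_sub : x * ↑s⁻¹ - x = x * ↑s⁻¹ * (1 - CFC.sqrt (star x * x)) := by
    rw [← hs, mul_sub, mul_one, mul_assoc x, Units.inv_mul, mul_one]
  rw [h_sub, CStarRing.norm_mem_unitary_mul _ hw]
  exact (norm_one_sub_sqrt_le h_nonneg).trans h_left

end Polar

section HasSymbol

variable {X : Type*} [TopologicalSpace X] {E : Type*} [CStarAlgebra E]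
  {ι : Type*} {l : Filter ι} {f : ι → C(X, ℂ) →⋆ₐ[ℂ] E} {x y : ι → E} {g h : C(X, E)}

/-- The net `x` in `E` is asymptotically equal to the function `g : C(X, E)` evaluated at the
"operator variables" `f i`, where `g` is a finite sum of functions `t ↦ φ t • a`. -/
def HasSymbol (l : Filter ι) (f : ι → C(X, ℂ) →⋆ₐ[ℂ] E) (x : ι → E) (g : C(X, E)) : Prop :=
  ∃ z, symbol z = g ∧ Tendsto (fun i => x i - evalSymbol (f i) z) l (𝓝 0)

theorem hasSymbol_evalSymbol (z : C(X, ℂ) ⊗[ℂ] E) :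
    HasSymbol l f (fun i => evalSymbol (f i) z) (symbol z) :=
  ⟨z, rfl, by simp only [sub_self, tendsto_const_nhds]⟩

namespace HasSymbol

theorem const (a : E) : HasSymbol l f (fun _ => a) (ContinuousMap.const X a) := by
  refine ⟨1 ⊗ₜ a, ContinuousMap.ext fun t => ?_, ?_⟩
  · rw [symbol_tmul_apply, ContinuousMap.one_apply, one_smul, ContinuousMap.const_apply]
  · simp only [evalSymbol_tmul, map_one, one_mul, sub_self, tendsto_const_nhds]

theorem sub (hx : HasSymbol l f x g) (hy : HasSymbol l f y h) :
    HasSymbol l f (fun i => x i - y i) (g - h) := by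
  obtain ⟨z, rfl, hz⟩ := hx
  obtain ⟨w, rfl, hw⟩ := hy
  refine ⟨z - w, map_sub _ _ _, ((hz.sub hw).congr fun i => ?_).trans_eq (by rw [sub_zero])⟩
  rw [map_sub, sub_sub_sub_comm]

theorem map (hx : HasSymbol l f x g) (β : E →⋆ₐ[ℂ] E) (τ : C(X, X))
    (hτ : ∀ φ, Tendsto (fun i => β (f i φ) - f i (φ.comp τ)) l (𝓝 0)) :
    HasSymbol l f (fun i => β (x i)) ((⟨β, map_continuous β⟩ : C(E, E)).comp (g.comp τ)) := by
  obtain ⟨z, rfl, hz⟩ := hx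
  let T : C(X, ℂ) ⊗[ℂ] E →ₗ[ℂ] C(X, ℂ) ⊗[ℂ] E := TensorProduct.map
    (ContinuousMap.compStarAlgHom' ℂ ℂ τ).toAlgHom.toLinearMap β.toAlgHom.toLinearMap
  have hT_tmul (φ : C(X, ℂ)) (a : E) : T (φ ⊗ₜ a) = φ.comp τ ⊗ₜ β a := rfl
  have hT_symbol (z : C(X, ℂ) ⊗[ℂ] E) (t : X) : symbol (T z) t = β (symbol z (τ t)) := by
    induction z with
    | zero => simp only [map_zero, ContinuousMap.zero_apply]
    | add z w hz hw => simp only [map_add, ContinuousMap.add_apply, hz, hw]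
    | tmul φ a =>
      rw [hT_tmul, symbol_tmul_apply, symbol_tmul_apply, map_smul, ContinuousMap.comp_apply]
  have hT_eval (z : C(X, ℂ) ⊗[ℂ] E) :
      Tendsto (fun i => β (evalSymbol (f i) z) - evalSymbol (f i) (T z)) l (𝓝 0) := by
    induction z with
    | zero => simp only [map_zero, sub_self, tendsto_const_nhds]
    | add z w hz hw =>
      refine ((hz.add hw).congr fun i => ?_).trans_eq (by rw [add_zero])
      simp only [map_add, add_sub_add_comm]
    | tmul φ a =>
      have h_mul := (hτ φ).mul (tendsto_const_nhds (x := β a))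
      rw [zero_mul] at h_mul
      refine h_mul.congr fun i => ?_
      rw [hT_tmul, evalSymbol_tmul, evalSymbol_tmul, map_mul, sub_mul]
  refine ⟨T z, ContinuousMap.ext (hT_symbol z), ?_⟩
  have h_sum := (((map_continuous β).tendsto' 0 0 (map_zero β)).comp hz).add (hT_eval z)
  rw [add_zero] at h_sum
  refine h_sum.congr fun i => ?_
  rw [Function.comp_apply, map_sub, sub_add_sub_cancel]

variable [CompactSpace X]

theorem star (hf : IsAsymptoticallyCentral l f) (hx : HasSymbol l f x g) :
    HasSymbol l f (fun i => star (x i)) (star g) := by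
  obtain ⟨z, rfl, hz⟩ := hx
  refine ⟨Star.star z, symbol_star z, ?_⟩
  have h_sub := hz.star.sub (hf.tendsto_evalSymbol_star z)
  rw [star_zero, sub_zero] at h_sub
  refine h_sub.congr fun i => ?_
  rw [star_sub]
  exact sub_sub_sub_cancel_right _ _ _

variable [T2Space X]

theorem eventually_norm_lt (hf : IsAsymptoticallyCentral l f) (hx : HasSymbol l f x g) {M : ℝ}
    (hM : ‖g‖ < M) : ∀ᶠ i in l, ‖x i‖ < M := by
  obtain ⟨z, rfl, hz⟩ := hx
  obtain ⟨K, hzK, hKM⟩ := exists_between hM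
  filter_upwards [hf.eventually_norm_evalSymbol_lt hzK,
    (tendsto_zero_iff_norm_tendsto_zero.1 hz).eventually_lt_const (sub_pos.2 hKM)] with i hi hxi
  linarith [norm_sub_norm_le (x i) (evalSymbol (f i) z)]

theorem isBoundedUnder (hf : IsAsymptoticallyCentral l f) (hx : HasSymbol l f x g) :
    IsBoundedUnder (· ≤ ·) l (norm ∘ x) :=
  isBoundedUnder_of_eventually_le <|
    (hx.eventually_norm_lt hf (lt_add_one ‖g‖)).mono fun _ => le_of_lt

theorem mul (hf : IsAsymptoticallyCentral l f) (hx : HasSymbol l f x g)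
    (hy : HasSymbol l f y h) : HasSymbol l f (fun i => x i * y i) (g * h) := by
  have hy_bounded := hy.isBoundedUnder hf
  obtain ⟨z, rfl, hz⟩ := hx
  obtain ⟨w, rfl, hw⟩ := hy
  refine ⟨z * w, map_mul _ _ _, ?_⟩
  have h_sum := ((hz.zero_mul_isBoundedUnder_le hy_bounded).add
    (isBoundedUnder_le_mul_tendsto_zero ((hasSymbol_evalSymbol z).isBoundedUnder hf) hw)).sub
    (hf.tendsto_evalSymbol_mul z w)
  rw [add_zero, sub_zero] at h_sum
  refine h_sum.congr fun i => ?_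
  noncomm_ring

end HasSymbol

end HasSymbol

section Averaging

theorem norm_commutator_le {R : Type*} [SeminormedRing R] (w x a : R) :
    ‖w * a - a * w‖ ≤ ‖x * a - a * x‖ + 2 * (‖w - x‖ * ‖a‖) := by
  have h_split : w * a - a * w = (x * a - a * x) + ((w - x) * a - a * (w - x)) := by noncomm_ring
  rw [h_split]
  refine (norm_add_le _ _).trans (add_le_add_right ((norm_sub_le _ _).trans ?_) _)
  linarith [norm_mul_le (w - x) a, norm_mul_le a (w - x)]

theorem norm_star_mul_mul_sub_le {R : Type*} [SeminormedRing R] [StarRing R]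
    [NormedStarGroup R] (w x d : R) :
    ‖star w * d * w - star x * d * x‖ ≤ (‖w‖ + ‖x‖) * (‖w - x‖ * ‖d‖) := by
  have h_split : star w * d * w - star x * d * x =
      star (w - x) * d * w + star x * d * (w - x) := by
    rw [star_sub]
    noncomm_ring
  calc ‖star w * d * w - star x * d * x‖
      ≤ ‖star (w - x)‖ * ‖d‖ * ‖w‖ + ‖star x‖ * ‖d‖ * ‖w - x‖ := by
        rw [h_split]
        exact (norm_add_le _ _).trans (add_le_add norm_mul₃_le norm_mul₃_le)
    _ = (‖w‖ + ‖x‖) * (‖w - x‖ * ‖d‖) := by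
        rw [norm_star, norm_star]
        ring

variable {G : Type*} [Group G] [TopologicalSpace G] [IsTopologicalGroup G]
  {E : Type*} [CStarAlgebra E] {β : G →* (E ≃⋆ₐ[ℂ] E)} (hβ : ∀ a, Continuous fun x => β x a)

/-- The equivariant embedding of `E` into `C(G, E)` which sends `a` to the orbit function
`x ↦ β x⁻¹ a`. It is fixed by the diagonal action `g ↦ fun x => β c (g (x * c))`. -/
def orbitMap : E →⋆ₐ[ℂ] C(G, E) where
  toFun a := ⟨fun x => β x⁻¹ a, (hβ a).comp continuous_inv⟩
  map_one' := ContinuousMap.ext fun x => map_one (β x⁻¹)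
  map_mul' a b := ContinuousMap.ext fun x => map_mul (β x⁻¹) a b
  map_zero' := ContinuousMap.ext fun x => map_zero (β x⁻¹)
  map_add' a b := ContinuousMap.ext fun x => map_add (β x⁻¹) a b
  commutes' z := ContinuousMap.ext fun x => AlgHomClass.commutes (β x⁻¹) z
  map_star' a := ContinuousMap.ext fun x => map_star (β x⁻¹) a

/-- The diagonal action of `c : G` on `C(G, E)`. -/
def diagonalShift (β : G →* (E ≃⋆ₐ[ℂ] E)) (c : G) (g : C(G, E)) : C(G, E) :=
  (⟨β c, map_continuous (β c)⟩ : C(E, E)).comp (g.comp (ContinuousMap.mulRight c))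

theorem diagonalShift_orbitMap (c : G) (a : E) :
    diagonalShift β c (orbitMap hβ a) = orbitMap hβ a := by
  ext x
  change β c (β (x * c)⁻¹ a) = β x⁻¹ a
  rw [← StarAlgEquiv.mul_apply, ← map_mul, mul_inv_rev, mul_inv_cancel_left]

theorem continuous_diagonalShift (c : G) : Continuous (diagonalShift β c) :=
  (ContinuousMap.continuous_postcomp _).comp (ContinuousMap.continuous_precomp _)

variable [CompactSpace G] {ι : Type*} {l : Filter ι} {f : ι → C(G, ℂ) →⋆ₐ[ℂ] E}

theorem eventually_nhds_orbitMap (v : unitary E) (C : Finset G) {F : Finset E} {ε ε' η : ℝ}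
    (hη : 0 < η) (hε : ε < ε') (hF : ∀ a ∈ F, ∀ x, ‖β x v * a - a * β x v‖ ≤ ε) :
    ∀ᶠ g in 𝓝 (orbitMap hβ v), ‖star g * g - 1‖ < η ∧ ‖g * star g - 1‖ < η ∧
      (∀ c ∈ C, ‖diagonalShift β c g - g‖ < η) ∧
      ∀ a ∈ F, ‖g * ContinuousMap.const G a - ContinuousMap.const G a * g‖ < ε' := by
  refine .and ?_ <| .and ?_ <| .and ?_ ?_
  · refine (isOpen_lt (by fun_prop) continuous_const).mem_nhds ?_
    rwa [Set.mem_ofPred_eq, ← map_star, ← map_mul, Unitary.star_mul_self_of_mem v.2, map_one,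
      sub_self, norm_zero]
  · refine (isOpen_lt (by fun_prop) continuous_const).mem_nhds ?_
    rwa [Set.mem_ofPred_eq, ← map_star, ← map_mul, Unitary.mul_star_self_of_mem v.2, map_one,
      sub_self, norm_zero]
  · refine C.eventually_all.2 fun c _ => (isOpen_lt
      ((continuous_diagonalShift c).sub continuous_id).norm continuous_const).mem_nhds ?_
    rwa [Set.mem_ofPred_eq, diagonalShift_orbitMap, sub_self, norm_zero]
  · refine F.eventually_all.2 fun a ha =>
      (isOpen_lt (by fun_prop) continuous_const).mem_nhds ?_
    exact ((ContinuousMap.norm_le_of_nonempty _).2 fun x => hF a ha x⁻¹).trans_lt hε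

theorem eventually_nhds_orbitMap_conj {v d s : E} (hd : ∀ x, β x d = d) {ε ε' δ : ℝ}
    (hs : ‖star v * d * v - s‖ ≤ ε) (hε : ε + δ < ε') {h : C(G, E)}
    (hh : ‖h - orbitMap hβ s‖ ≤ δ) :
    ∀ᶠ g in 𝓝 (orbitMap hβ v), ‖star g * ContinuousMap.const G d * g - h‖ < ε' := by
  refine (isOpen_lt (by fun_prop) continuous_const).mem_nhds ?_
  have h_const : ContinuousMap.const G d = orbitMap hβ d :=
    ContinuousMap.ext fun x => (hd x⁻¹).symm
  have h_norm := NonUnitalStarAlgHom.norm_apply_le (orbitMap hβ) (star v * d * v - s)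
  rw [map_sub, map_mul, map_mul, map_star, ← h_const] at h_norm
  rw [norm_sub_rev] at hh
  exact (norm_sub_le_norm_sub_add_norm_sub _ (orbitMap hβ s) _).trans_lt (by linarith)

variable [T2Space G] [l.NeBot]

theorem exists_almost_invariant_almost_unitary
    (hβ : ∀ a, Continuous fun x => β x a) (hf : IsAsymptoticallyCentral l f)
    (hfβ : ∀ c φ,
      Tendsto (fun i => β c (f i φ) - f i (φ.comp (ContinuousMap.mulRight c))) l (𝓝 0))
    {S : Subalgebra ℂ E} (hfS : ∀ i φ, f i φ ∈ S) (hβS : ∀ x, ∀ s ∈ S, β x s ∈ S)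
    (v : unitary E) (C : Finset G) {F T : Finset E} (hT : ∀ d ∈ T, ∀ x, β x d = d)
    {ε ε' η : ℝ} (hη : 0 < η) (hε : ε < ε') (hF : ∀ a ∈ F, ∀ x, ‖β x v * a - a * β x v‖ ≤ ε)
    (hvT : ∀ d ∈ T, ∃ s ∈ S, ‖star (v : E) * d * v - s‖ ≤ ε) :
    ∃ y : E, ‖star y * y - 1‖ < η ∧ ‖y * star y - 1‖ < η ∧ (∀ c ∈ C, ‖β c y - y‖ < η) ∧
      (∀ a ∈ F, ‖y * a - a * y‖ < ε') ∧ ∀ d ∈ T, ∃ s ∈ S, ‖star y * d * y - s‖ < ε' := by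
  choose! s hsS hs using hvT
  choose z hz hzS using fun d =>
    exists_norm_symbol_sub_le (orbitMap hβ (s d)) (half_pos (sub_pos.2 hε))
  have h_near := (eventually_nhds_orbitMap hβ v C hη hε hF).and <|
    T.eventually_all.2 fun d hd => eventually_nhds_orbitMap_conj hβ (hT d hd) (hs d hd)
      (show ε + (ε' - ε) / 2 < ε' by linarith) (hz d)
  obtain ⟨z₀, ⟨h_left, h_right, hC, hF₀⟩, hT₀⟩ := denseRange_symbol.mem_nhds h_near
  have hy : HasSymbol l f (fun i => evalSymbol (f i) z₀) (symbol z₀) := hasSymbol_evalSymbol z₀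
  have hy_star := hy.star hf
  have h_good := ((((hy_star.mul hf hy).sub (.const 1)).eventually_norm_lt hf h_left).and
    (((hy.mul hf hy_star).sub (.const 1)).eventually_norm_lt hf h_right)).and <|
    (C.eventually_all.2 fun c hc => ((hy.map (β c) _ (hfβ c)).sub hy).eventually_norm_lt hf
      (hC c hc)).and <|
    (F.eventually_all.2 fun a ha => ((hy.mul hf (.const a)).sub
      ((HasSymbol.const a).mul hf hy)).eventually_norm_lt hf (hF₀ a ha)).and <|
    T.eventually_all.2 fun d hd => (((hy_star.mul hf (.const d)).mul hf hy).sub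
      (hasSymbol_evalSymbol (z d))).eventually_norm_lt hf (hT₀ d hd)
  obtain ⟨i, ⟨hi_left, hi_right⟩, hiC, hiF, hiT⟩ := h_good.exists
  exact ⟨evalSymbol (f i) z₀, hi_left, hi_right, hiC, hiF, fun d hd =>
    ⟨_, hzS d (f i) S (hfS i) fun x => hβS _ _ (hsS d hd), hiT d hd⟩⟩

theorem exists_almost_invariant_unitary
    (hβ : ∀ a, Continuous fun x => β x a) (hf : IsAsymptoticallyCentral l f)
    (hfβ : ∀ c φ,
      Tendsto (fun i => β c (f i φ) - f i (φ.comp (ContinuousMap.mulRight c))) l (𝓝 0))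
    {S : Subalgebra ℂ E} (hfS : ∀ i φ, f i φ ∈ S) (hβS : ∀ x, ∀ s ∈ S, β x s ∈ S)
    (v : unitary E) (C : Finset G) {F T : Finset E} (hT : ∀ d ∈ T, ∀ x, β x d = d)
    {ε : ℝ} (hε : 0 < ε) (hF : ∀ a ∈ F, ∀ x, ‖β x v * a - a * β x v‖ ≤ ε)
    (hvT : ∀ d ∈ T, ∃ s ∈ S, ‖star (v : E) * d * v - s‖ ≤ ε) :
    ∃ w : unitary E, (∀ c ∈ C, ‖β c w - w‖ < 2 * ε) ∧
      (∀ a ∈ F, ‖(w : E) * a - a * w‖ < 2 * ε) ∧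
      ∀ d ∈ T, ∃ s ∈ S, ‖star (w : E) * d * w - s‖ < 2 * ε := by
  classical
  obtain ⟨η, hη, hη_one, hηε, hηFT⟩ : ∃ η > 0, η < 1 ∧ 3 * η < 2 * ε ∧
      ∀ a ∈ F ∪ T, 3 * (η * ‖a‖) < ε / 2 := by
    have h_small {g : ℝ → ℝ} (hg : Continuous g) {M : ℝ} (hM : g 0 < M) :
        ∀ᶠ η in 𝓝[>] 0, g η < M :=
      ((hg.tendsto 0).mono_left nhdsWithin_le_nhds).eventually_lt_const hM
    exact (eventually_mem_nhdsWithin.and <| (h_small continuous_id one_pos).and <|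
      (h_small (by fun_prop) (by linarith)).and <| (F ∪ T).eventually_all.2 fun a _ =>
        h_small (by fun_prop) (by linarith)).exists
  obtain ⟨y, hy_left, hy_right, hyC, hyF, hyT⟩ := exists_almost_invariant_almost_unitary hβ hf hfβ
    hfS hβS v C hT hη (show ε < 3 / 2 * ε by linarith) hF hvT
  obtain ⟨w, hw⟩ := exists_unitary_norm_sub_le hη_one hy_left.le hy_right.le
  refine ⟨w, fun c hc => ?_, fun a ha => ?_, fun d hd => ?_⟩
  · have h_isometry := StarAlgEquiv.norm_map (β c) (w - y)
    rw [map_sub] at h_isometry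
    have h_right := norm_sub_le_norm_sub_add_norm_sub (β c y) y w
    rw [norm_sub_rev y] at h_right
    linarith [hyC c hc, norm_sub_le_norm_sub_add_norm_sub (β c w) (β c y) w]
  · have h_le := mul_le_mul_of_nonneg_right hw (norm_nonneg a)
    linarith [hyF a ha, norm_commutator_le (w : E) y a, hηFT a (Finset.mem_union_left _ ha)]
  · obtain ⟨s, hs, hys⟩ := hyT d hd
    refine ⟨s, hs, ?_⟩
    have hw_norm : ‖(w : E)‖ ≤ 1 := by
      nontriviality E
      exact (CStarRing.norm_of_mem_unitary w.2).le
    have hy_norm : ‖(w : E)‖ + ‖y‖ ≤ 3 := by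
      linarith [norm_le_norm_add_norm_sub (w : E) y]
    have h_le := mul_le_mul_of_nonneg_right hw (norm_nonneg d)
    have h_conj := (norm_star_mul_mul_sub_le (w : E) y d).trans
      (mul_le_mul hy_norm h_le (by positivity) (by norm_num))
    linarith [hηFT d (Finset.mem_union_right _ hd),
      norm_sub_le_norm_sub_add_norm_sub (star (w : E) * d * w) (star y * d * y) s]

end Averaging

section CircleFunctionalCalculus

/-- The coordinate function of the circle. -/
def circleCoord : C(Circle, ℂ) :=
  ⟨(↑), continuous_subtype_val⟩

theorem circleCoord_comp_mulRight (c : Circle) :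
    circleCoord.comp (ContinuousMap.mulRight c) = (c : ℂ) • circleCoord :=
  ContinuousMap.ext fun x => (Circle.coe_mul x c).trans (mul_comm _ _)

theorem subalgebra_eq_top_of_circleCoord_mem {S : Subalgebra ℂ C(Circle, ℂ)}
    (hS : IsClosed (S : Set C(Circle, ℂ))) (hz : circleCoord ∈ S) (hz_star : star circleCoord ∈ S) :
    S = ⊤ := by
  have h_adjoin : (StarAlgebra.adjoin ℂ {circleCoord} : Set C(Circle, ℂ)) ⊆ S := by
    rw [← StarSubalgebra.coe_toSubalgebra, SetLike.coe_subset_coe, StarAlgebra.adjoin_toSubalgebra,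
      Algebra.adjoin_le_iff, Set.star_singleton]
    exact Set.union_subset (Set.singleton_subset_iff.2 hz) (Set.singleton_subset_iff.2 hz_star)
  have h_dense := ContinuousMap.starSubalgebra_topologicalClosure_eq_top_of_separatesPoints
    (StarAlgebra.adjoin ℂ {circleCoord}) fun x y hxy =>
      ⟨circleCoord, ⟨circleCoord, StarAlgebra.self_mem_adjoin_singleton ℂ _, rfl⟩,
        fun h => hxy (Circle.ext h)⟩
  refine eq_top_iff.2 fun φ _ => closure_minimal h_adjoin hS ?_
  rw [← StarSubalgebra.topologicalClosure_coe, h_dense]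
  exact StarSubalgebra.mem_top

variable {E : Type*} [CStarAlgebra E]

/-- The continuous functional calculus of a unitary `u`, as a homomorphism from `C(𝕋)`. -/
noncomputable def circleFunctionalCalculus (u : unitary E) : C(Circle, ℂ) →⋆ₐ[ℂ] E :=
  (cfcHom (R := ℂ) (a := (u : E)) (Unitary.coe_isStarNormal u)).comp <|
    ContinuousMap.compStarAlgHom' ℂ ℂ
      ⟨fun z : spectrum ℂ (u : E) => (⟨z, Unitary.spectrum_subset_circle u z.2⟩ : Circle),
        continuous_subtype_val.subtype_mk _⟩

theorem circleFunctionalCalculus_circleCoord (u : unitary E) :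
    circleFunctionalCalculus u circleCoord = u :=
  cfcHom_id (R := ℂ) (a := (u : E)) (Unitary.coe_isStarNormal u)

variable {ι : Type*} {l : Filter ι} {u : ι → unitary E}

theorem isAsymptoticallyCentral_circleFunctionalCalculus
    (hu : ∀ x, Tendsto (fun i => (u i : E) * x - x * u i) l (𝓝 0)) :
    IsAsymptoticallyCentral l fun i => circleFunctionalCalculus (u i) := by
  have h_top (x : E) : asymptoticCommutant l (fun i => circleFunctionalCalculus (u i))
      (fun _ => x) = ⊤ := by
    refine subalgebra_eq_top_of_circleCoord_mem (isClosed_asymptoticCommutant fun _ => le_rfl)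
      (mem_asymptoticCommutant.2 ?_) (mem_asymptoticCommutant.2 ?_)
    · have h_neg := (hu x).neg
      rw [neg_zero] at h_neg
      simpa only [circleFunctionalCalculus_circleCoord, neg_sub] using h_neg
    · have h_star := (hu (star x)).star
      rw [star_zero] at h_star
      simpa only [map_star, circleFunctionalCalculus_circleCoord, star_sub, star_mul, star_star]
        using h_star
  intro φ x
  have h_neg := (mem_asymptoticCommutant.1 (h_top x ▸ Algebra.mem_top : φ ∈ _)).neg
  simpa only [neg_sub, neg_zero] using h_neg

theorem tendsto_circleFunctionalCalculus_comp_mulRight {β : E →⋆ₐ[ℂ] E} {c : Circle}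
    (hu : Tendsto (fun i => β (u i) - (c : ℂ) • (u i : E)) l (𝓝 0)) (φ : C(Circle, ℂ)) :
    Tendsto (fun i => β (circleFunctionalCalculus (u i) φ) -
      circleFunctionalCalculus (u i) (φ.comp (ContinuousMap.mulRight c))) l (𝓝 0) := by
  let rot : C(Circle, ℂ) →⋆ₐ[ℂ] C(Circle, ℂ) :=
    ContinuousMap.compStarAlgHom' ℂ ℂ (ContinuousMap.mulRight c)
  have h_top : asymptoticEqualizer l (fun i => β.comp (circleFunctionalCalculus (u i)))
      (fun i => (circleFunctionalCalculus (u i)).comp rot) = ⊤ := by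
    have h_coord : Tendsto (fun i => β (circleFunctionalCalculus (u i) circleCoord) -
        circleFunctionalCalculus (u i) (rot circleCoord)) l (𝓝 0) := by
      refine hu.congr fun i => ?_
      rw [show rot circleCoord = _ from circleCoord_comp_mulRight c, map_smul,
        circleFunctionalCalculus_circleCoord]
    refine subalgebra_eq_top_of_circleCoord_mem (isClosed_asymptoticEqualizer _ _) h_coord
      (mem_asymptoticEqualizer.2 ?_)
    have h_star := h_coord.star
    rw [star_zero] at h_star
    simpa only [StarAlgHom.comp_apply, map_star, star_sub] using h_star
  exact mem_asymptoticEqualizer.1 (h_top ▸ Algebra.mem_top)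

end CircleFunctionalCalculus

namespace CrossedProduct

variable {A : Type u} [CStarAlgebra A] {G : Type} [Group G] [DecidableEq G]

theorem crossedDiag_add (α : G →* (A ≃⋆ₐ[ℂ] A)) (a b : A) :
    crossedDiag α (a + b) = crossedDiag α a + crossedDiag α b := by
  refine Eq.trans ?_ (Matrix.diagonal_add (fun g => α g⁻¹ a) fun g => α g⁻¹ b).symm
  exact congrArg _ (congrArg _ (funext fun g => map_add _ _ _))

theorem crossedDiag_star (α : G →* (A ≃⋆ₐ[ℂ] A)) (a : A) :
    crossedDiag α (star a) = star (crossedDiag α a) := by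
  refine Eq.trans ?_ (Matrix.diagonal_conjTranspose fun g => α g⁻¹ a).symm
  exact congrArg _ (congrArg _ (funext fun g => map_star _ _))

theorem star_crossedUnitary (s : G) : star (crossedUnitary A s) = crossedUnitary A s⁻¹ := by
  ext g h
  change star (if h = s * g then (1 : A) else 0) = if g = s⁻¹ * h then 1 else 0
  simp only [apply_ite star, star_one, star_zero, eq_inv_mul_iff_mul_eq, eq_comm]

section

variable [Fintype G]

attribute [local instance] CStarAlgebra.spectralOrder CStarAlgebra.spectralOrderedRing

theorem crossedDiag_mul (α : G →* (A ≃⋆ₐ[ℂ] A)) (a b : A) :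
    crossedDiag α (a * b) = crossedDiag α a * crossedDiag α b := by
  refine Eq.trans ?_ (Matrix.diagonal_mul_diagonal (fun g => α g⁻¹ a) fun g => α g⁻¹ b).symm
  exact congrArg _ (congrArg _ (funext fun g => map_mul _ _ _))

theorem crossedDiag_algebraMap (α : G →* (A ≃⋆ₐ[ℂ] A)) (c : ℂ) :
    crossedDiag α (algebraMap ℂ A c) = algebraMap ℂ (CStarMatrix G G A) c := by
  ext g h
  rw [CStarMatrix.algebraMap_apply]
  change Matrix.diagonal (fun g => α g⁻¹ (algebraMap ℂ A c)) g h = _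
  rw [Matrix.diagonal_apply]
  simp only [AlgHomClass.commutes]

variable (α : G →* (A ≃⋆ₐ[ℂ] A))

/-- The inclusion of the crossed product in the matrices over `A` in which it is constructed. -/
noncomputable def val : CrossedProduct α →⋆ₐ[ℂ] CStarMatrix G G A :=
  StarSubalgebra.subtype (crossedSubalgebra α)

theorem isEmbedding_val : Topology.IsEmbedding (val α) := .subtypeVal

theorem val_injective : Function.Injective (val α) := (isEmbedding_val α).injective

/-- The canonical embedding of `A` in the crossed product. -/
noncomputable def embed : A →⋆ₐ[ℂ] CrossedProduct α where
  toFun a := (⟨crossedDiag α a, StarSubalgebra.le_topologicalClosure _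
    (StarAlgebra.subset_adjoin ℂ _ (Or.inl ⟨a, rfl⟩))⟩ : crossedSubalgebra α)
  map_one' := val_injective α <| by
    have h := crossedDiag_algebraMap α 1
    rw [map_one, map_one] at h
    exact h
  map_mul' a b := val_injective α (crossedDiag_mul α a b)
  map_zero' := val_injective α <| by
    have h := crossedDiag_algebraMap α 0
    rw [map_zero, map_zero] at h
    exact h
  map_add' a b := val_injective α (crossedDiag_add α a b)
  commutes' c := val_injective α (crossedDiag_algebraMap α c)
  map_star' a := val_injective α (crossedDiag_star α a)

/-- The canonical unitary of the crossed product implementing the automorphism `α s`. -/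
noncomputable def gen (s : G) : CrossedProduct α :=
  (⟨crossedUnitary A s, StarSubalgebra.le_topologicalClosure _
    (StarAlgebra.subset_adjoin ℂ _ (Or.inr ⟨s, rfl⟩))⟩ : crossedSubalgebra α)

theorem gen_mul_embed (s : G) (a : A) : gen α s * embed α a = embed α (α s a) * gen α s := by
  refine val_injective α ?_
  ext g h
  refine (Matrix.mul_diagonal (fun h => α h⁻¹ a) _ g h).trans
    (Eq.trans ?_ (Matrix.diagonal_mul (fun g => α g⁻¹ (α s a)) _ g h).symm)
  change (if g = s * h then (1 : A) else 0) * α h⁻¹ a =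
    α g⁻¹ (α s a) * (if g = s * h then (1 : A) else 0)
  split_ifs with hg
  · rw [one_mul, mul_one, hg, ← StarAlgEquiv.mul_apply, ← map_mul, mul_inv_rev,
      inv_mul_cancel_right]
  · rw [zero_mul, mul_zero]

variable {α}

theorem subalgebra_eq_top {S : Subalgebra ℂ (CrossedProduct α)}
    (hS : IsClosed (S : Set (CrossedProduct α))) (hembed : ∀ a, embed α a ∈ S)
    (hgen : ∀ s, gen α s ∈ S) : S = ⊤ := by
  have hadjoin : (StarAlgebra.adjoin ℂ (Set.range (crossedDiag α) ∪
      Set.range (crossedUnitary A (G := G)))).toSubalgebra ≤ S.map (val α).toAlgHom := by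
    rw [StarAlgebra.adjoin_toSubalgebra, Algebra.adjoin_le_iff]
    rintro y ((⟨a, rfl⟩ | ⟨s, rfl⟩) | (⟨a, ha⟩ | ⟨s, hs⟩))
    · exact ⟨embed α a, hembed a, rfl⟩
    · exact ⟨gen α s, hgen s, rfl⟩
    · exact ⟨embed α (star a), hembed _,
        (crossedDiag_star α a).trans (star_eq_iff_star_eq.1 ha.symm)⟩
    · exact ⟨gen α s⁻¹, hgen _,
        (star_crossedUnitary s).symm.trans (star_eq_iff_star_eq.1 hs.symm)⟩
  refine eq_top_iff.2 fun x _ => hS.closure_subset ?_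
  rw [(isEmbedding_val α).closure_eq_preimage_closure_image]
  exact closure_mono hadjoin x.2

theorem separableSpace [TopologicalSpace.SeparableSpace A] :
    TopologicalSpace.SeparableSpace (CrossedProduct α) := by
  refine separableSpace_of_forall_isClosed_eq_top
    (s := Set.range (embed α) ∪ Set.range (gen α))
    ((TopologicalSpace.isSeparable_range (map_continuous (embed α))).union
      (Set.finite_range (gen α)).countable.isSeparable) fun S hS h => ?_
  exact subalgebra_eq_top hS (fun a => h (Or.inl ⟨a, rfl⟩)) fun s => h (Or.inr ⟨s, rfl⟩)

theorem nontrivial [Nontrivial A] : Nontrivial (CrossedProduct α) :=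
  (val α).toRingHom.domain_nontrivial

end

end CrossedProduct

section CentralSequences

variable {ι : Type*} {l : Filter ι}

theorem tendsto_map_commutator {B E : Type*} [CStarAlgebra B] [CStarAlgebra E] (g : B →⋆ₐ[ℂ] E)
    {v : ι → B} {b : B} (h : Tendsto (fun i => v i * b - b * v i) l (𝓝 0)) :
    Tendsto (fun i => g (v i) * g b - g b * g (v i)) l (𝓝 0) := by
  refine (((map_continuous g).tendsto' 0 0 (map_zero g)).comp h).congr fun i => ?_
  rw [Function.comp_apply, map_sub, map_mul, map_mul]

theorem eventually_forall_norm_commutator_lt {B E : Type*} [CStarAlgebra B] [CStarAlgebra E]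
    {f : ι → B →⋆ₐ[ℂ] E} {v : ι → E} {M : ℝ} (hv : ∀ i, ‖v i‖ ≤ M)
    (h : asymptoticCommutant l f v = ⊤) {K : Set B} (hK : IsCompact K) {ε : ℝ} (hε : 0 < ε) :
    ∀ᶠ i in l, ∀ b ∈ K, ‖v i * f i b - f i b * v i‖ < ε := by
  have h_equicontinuous := (uniformEquicontinuous_commutator f hv).equicontinuous
  have h_covers : ⋃₀ {K : Set B | IsCompact K} = Set.univ :=
    Set.sUnion_eq_univ_iff.2 fun b => ⟨{b}, isCompact_singleton, rfl⟩
  have h_pointwise : Tendsto (fun i b => v i * f i b - f i b * v i) l (𝓝 fun _ => 0) :=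
    tendsto_pi_nhds.2 fun b => mem_asymptoticCommutant.1 (h ▸ Algebra.mem_top)
  have h_uniform : TendstoUniformlyOn (fun i b => v i * f i b - f i b * v i) (fun _ => 0) l K :=
    UniformOnFun.tendsto_iff_tendstoUniformlyOn.1
      ((EquicontinuousOn.tendsto_uniformOnFun_iff_pi (fun _ hK => hK) h_covers
        (fun K _ => h_equicontinuous.equicontinuousOn K) l _).2 h_pointwise) K hK
  filter_upwards [Metric.tendstoUniformlyOn_iff.1 h_uniform ε hε] with i hi b hb
  simpa only [dist_zero_left] using hi b hb

namespace IsAsymptoticallyCentral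

theorem comp_of_surjective {B E C : Type*} [CStarAlgebra B] [CStarAlgebra E] [CStarAlgebra C]
    {f : ι → B →⋆ₐ[ℂ] E} (hf : IsAsymptoticallyCentral l f) {g : E →⋆ₐ[ℂ] C}
    (hg : Function.Surjective g) : IsAsymptoticallyCentral l fun i => g.comp (f i) :=
  fun b => hg.forall.2 fun x => tendsto_map_commutator g (hf b x)

variable {A D : Type u} {B : Type*} [CStarAlgebra A] [CStarAlgebra B] [CStarAlgebra D]

theorem of_inl_of_inr {f : ι → B →⋆ₐ[ℂ] MinTensor A D}
    (hinl : ∀ b a, Tendsto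
      (fun i => f i b * MinTensor.inl A D a - MinTensor.inl A D a * f i b) l (𝓝 0))
    (hinr : ∀ b d, Tendsto
      (fun i => f i b * MinTensor.inr A D d - MinTensor.inr A D d * f i b) l (𝓝 0)) :
    IsAsymptoticallyCentral l f := by
  intro b x
  have h_top : asymptoticCommutant l (fun _ => StarAlgHom.id ℂ (MinTensor A D))
      (fun i => f i b) = ⊤ :=
    MinTensor.subalgebra_eq_top
      (isClosed_asymptoticCommutant fun i => NonUnitalStarAlgHom.norm_apply_le (f i) b)
      (fun a => mem_asymptoticCommutant.2 (by simpa only [StarAlgHom.coe_id, id_eq] using hinl b a))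
      fun d => mem_asymptoticCommutant.2 (by simpa only [StarAlgHom.coe_id, id_eq] using hinr b d)
  have h_mem : x ∈ asymptoticCommutant l (fun _ => StarAlgHom.id ℂ (MinTensor A D))
      (fun i => f i b) := h_top ▸ Algebra.mem_top
  simpa only [mem_asymptoticCommutant, StarAlgHom.coe_id, id_eq] using h_mem

theorem inl_comp {f : ι → B →⋆ₐ[ℂ] A} (hf : IsAsymptoticallyCentral l f) :
    IsAsymptoticallyCentral l fun i => (MinTensor.inl A D).comp (f i) :=
  of_inl_of_inr (fun b a => tendsto_map_commutator (MinTensor.inl A D) (hf b a)) fun b d =>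
    tendsto_const_nhds.congr fun i =>
      (sub_eq_zero.2 (MinTensor.commute_inl_inr (f i b) d).eq).symm

theorem inr_comp {f : ι → B →⋆ₐ[ℂ] D} (hf : IsAsymptoticallyCentral l f) :
    IsAsymptoticallyCentral l fun i => (MinTensor.inr A D).comp (f i) :=
  of_inl_of_inr (fun b a => tendsto_const_nhds.congr fun i =>
      (sub_eq_zero.2 (MinTensor.commute_inl_inr a (f i b)).symm.eq).symm)
    fun b d => tendsto_map_commutator (MinTensor.inr A D) (hf b d)

end IsAsymptoticallyCentral

variable {A D : Type u} [CStarAlgebra A] [CStarAlgebra D]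

theorem IsStronglySelfAbsorbing.exists_isAsymptoticallyCentral (hD : IsStronglySelfAbsorbing D) :
    ∃ χ : ℕ → D →⋆ₐ[ℂ] D, IsAsymptoticallyCentral atTop χ := by
  obtain ⟨e, w, hw⟩ := hD.exists_equiv
  let f (k : ℕ) : D →⋆ₐ[ℂ] MinTensor D D :=
    (conjStarAlgAut ℂ (MinTensor D D) (w k) : MinTensor D D →⋆ₐ[ℂ] MinTensor D D).comp
      (MinTensor.inr D D)
  have hf : IsAsymptoticallyCentral atTop f := by
    intro d x
    obtain ⟨y, rfl⟩ : ∃ y, e y = x := e.surjective x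
    let c (k : ℕ) : MinTensor D D := conjStarAlgAut ℂ (MinTensor D D) (w k) (MinTensor.inl D D y)
    have h_commute (k : ℕ) : f k d * c k = c k * f k d :=
      ((MinTensor.commute_inl_inr y d).symm.map (conjStarAlgAut ℂ (MinTensor D D) (w k))).eq
    have hc : Tendsto (fun k => e y - c k) atTop (𝓝 0) := by
      have h_sub := (tendsto_const_nhds (x := e y)).sub (hw y)
      rwa [show (e : D →⋆ₐ[ℂ] MinTensor D D) y = e y from rfl, sub_self] at h_sub
    have h_bounded := isBoundedUnder_norm_map (l := atTop) f d
    have h_sub := (isBoundedUnder_le_mul_tendsto_zero h_bounded hc).sub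
      (hc.zero_mul_isBoundedUnder_le h_bounded)
    rw [sub_zero] at h_sub
    refine h_sub.congr fun k => ?_
    rw [mul_sub, sub_mul, h_commute, sub_sub_sub_cancel_right]
  exact ⟨_, hf.comp_of_surjective (g := (e.symm : MinTensor D D →⋆ₐ[ℂ] D)) e.symm.surjective⟩

theorem IsAbsorbing.exists_isAsymptoticallyCentral (hD : IsStronglySelfAbsorbing D)
    (hA : IsAbsorbing D A) : ∃ ψ : ℕ → D →⋆ₐ[ℂ] A, IsAsymptoticallyCentral atTop ψ := by
  obtain ⟨θ⟩ := hA
  obtain ⟨χ, hχ⟩ := hD.exists_isAsymptoticallyCentral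
  exact ⟨_, hχ.inr_comp.comp_of_surjective (g := (θ : MinTensor A D →⋆ₐ[ℂ] A)) θ.surjective⟩

theorem MinTensor.tendsto_map_id_commutator {ψ : ι → D →⋆ₐ[ℂ] A}
    (hψ : IsAsymptoticallyCentral l ψ) (z : MinTensor D D) (a : A) :
    Tendsto (fun i => map (ψ i) (StarAlgHom.id ℂ D) z * inl A D a -
      inl A D a * map (ψ i) (StarAlgHom.id ℂ D) z) l (𝓝 0) := by
  have h_top : asymptoticCommutant l (fun i => map (ψ i) (StarAlgHom.id ℂ D))
      (fun _ => inl A D a) = ⊤ := by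
    refine subalgebra_eq_top (isClosed_asymptoticCommutant fun _ => le_rfl)
      (fun d => mem_asymptoticCommutant.2 ?_) fun d => mem_asymptoticCommutant.2 ?_
    · have h_neg := (tendsto_map_commutator (inl A D) (hψ d a)).neg
      rw [neg_zero] at h_neg
      refine h_neg.congr fun i => ?_
      rw [map_inl, neg_sub]
    · refine tendsto_const_nhds.congr fun i => ?_
      rw [map_inr, (commute_inl_inr _ _).eq, sub_self]
  have h_neg := (mem_asymptoticCommutant.1 (h_top ▸ Algebra.mem_top : z ∈ _)).neg
  simpa only [neg_sub, neg_zero] using h_neg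

end CentralSequences

section TensorAction

variable {A D : Type u} [CStarAlgebra A] [CStarAlgebra D] {G : Type*} [Group G]

namespace MinTensor

theorem map_mul_comp_map_mul (α : G →* (A ≃⋆ₐ[ℂ] A)) (g h : G) :
    (map (α g : A →⋆ₐ[ℂ] A) (StarAlgHom.id ℂ D)).comp
      (map (α h : A →⋆ₐ[ℂ] A) (StarAlgHom.id ℂ D)) =
      map (α (g * h) : A →⋆ₐ[ℂ] A) (StarAlgHom.id ℂ D) := by
  refine hom_ext (fun a => ?_) fun d => ?_
  · rw [StarAlgHom.comp_apply, map_inl, map_inl, map_inl, map_mul]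
    rfl
  · rw [StarAlgHom.comp_apply, map_inr, map_inr, map_inr]
    rfl

theorem map_map_one (α : G →* (A ≃⋆ₐ[ℂ] A)) :
    map (α 1 : A →⋆ₐ[ℂ] A) (StarAlgHom.id ℂ D) = StarAlgHom.id ℂ (MinTensor A D) := by
  refine hom_ext (fun a => ?_) fun d => ?_
  · rw [map_inl, map_one]
    rfl
  · rw [map_inr]
    rfl

variable (D) in
/-- The action `α ⊗ id` on `A ⊗ D`. -/
noncomputable def tensorAction (α : G →* (A ≃⋆ₐ[ℂ] A)) :
    G →* (MinTensor A D ≃⋆ₐ[ℂ] MinTensor A D) where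
  toFun g := StarAlgEquiv.ofStarAlgHom (map (α g : A →⋆ₐ[ℂ] A) (StarAlgHom.id ℂ D))
    (map (α g⁻¹ : A →⋆ₐ[ℂ] A) (StarAlgHom.id ℂ D))
    (by rw [map_mul_comp_map_mul, inv_mul_cancel, map_map_one])
    (by rw [map_mul_comp_map_mul, mul_inv_cancel, map_map_one])
  map_one' := StarAlgEquiv.ext fun x => DFunLike.congr_fun (map_map_one α) x
  map_mul' g h := StarAlgEquiv.ext fun x =>
    (DFunLike.congr_fun (map_mul_comp_map_mul α g h) x).symm

theorem tensorAction_inl (α : G →* (A ≃⋆ₐ[ℂ] A)) (g : G) (a : A) :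
    tensorAction D α g (inl A D a) = inl A D (α g a) :=
  map_inl _ _ a

theorem tensorAction_inr (α : G →* (A ≃⋆ₐ[ℂ] A)) (g : G) (d : D) :
    tensorAction D α g (inr A D d) = inr A D d :=
  map_inr _ _ d

theorem tensorAction_comp {H : Type*} [Group H] (α : G →* (A ≃⋆ₐ[ℂ] A)) (κ : H →* G) (h : H) :
    tensorAction D (α.comp κ) h = tensorAction D α (κ h) :=
  StarAlgEquiv.ext fun _ => rfl

theorem continuous_tensorAction [TopologicalSpace G] {α : G →* (A ≃⋆ₐ[ℂ] A)}
    (hα : ∀ a, Continuous fun g => α g a) (x : MinTensor A D) :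
    Continuous fun g => tensorAction D α g x := by
  refine continuous_iff_continuousAt.2 fun g₀ => tendsto_sub_nhds_zero_iff.1 ?_
  have h_top : asymptoticEqualizer (𝓝 g₀)
      (fun g => (tensorAction D α g : MinTensor A D →⋆ₐ[ℂ] MinTensor A D))
      (fun _ => (tensorAction D α g₀ : MinTensor A D →⋆ₐ[ℂ] MinTensor A D)) = ⊤ := by
    refine subalgebra_eq_top (isClosed_asymptoticEqualizer _ _)
      (fun a => mem_asymptoticEqualizer.2 ?_) fun d => mem_asymptoticEqualizer.2 ?_
    · refine (tendsto_sub_nhds_zero_iff.2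
        ((((map_continuous (inl A D)).comp (hα a)).tendsto g₀))).congr fun g => ?_
      exact congrArg₂ _ (tensorAction_inl α g a).symm (tensorAction_inl α g₀ a).symm
    · refine tendsto_const_nhds.congr fun g => (sub_eq_zero.2 ?_).symm
      exact (tensorAction_inr α g d).trans (tensorAction_inr α g₀ d).symm
  exact mem_asymptoticEqualizer.1 (h_top ▸ Algebra.mem_top)

end MinTensor

end TensorAction

section AlmostInvariantUnitaries

variable {A D : Type u} [CStarAlgebra A] [CStarAlgebra D]

theorem IsAbsorbing.exists_unitary_conj_inr_near_inl (hD : IsStronglySelfAbsorbing D)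
    (hA : IsAbsorbing D A) {K : Set A} (hK : IsCompact K) (T : Finset D) {ε : ℝ} (hε : 0 < ε) :
    ∃ v : unitary (MinTensor A D),
      (∀ a ∈ K, ‖v * MinTensor.inl A D a - MinTensor.inl A D a * v‖ < ε) ∧
      ∀ d ∈ T, ∃ a, ‖star (v : MinTensor A D) * MinTensor.inr A D d * v -
        MinTensor.inl A D a‖ < ε := by
  obtain ⟨ψ, hψ⟩ := hA.exists_isAsymptoticallyCentral hD
  obtain ⟨w, hw⟩ := hD.inl_approxUnitarilyEquivalent_inr T ε hε
  let j (k : ℕ) : MinTensor D D →⋆ₐ[ℂ] MinTensor A D := MinTensor.map (ψ k) (StarAlgHom.id ℂ D)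
  let v (k : ℕ) : unitary (MinTensor A D) := ⟨j k w, Unitary.map_mem (j k) w.2⟩
  have h_top : asymptoticCommutant atTop (fun _ => MinTensor.inl A D)
      (fun k => (v k : MinTensor A D)) = ⊤ :=
    eq_top_iff.2 fun a _ => mem_asymptoticCommutant.2 (MinTensor.tendsto_map_id_commutator hψ w a)
  obtain ⟨k, hk⟩ := (eventually_forall_norm_commutator_lt
    (fun k => NonUnitalStarAlgHom.norm_apply_le (j k) (w : MinTensor D D)) h_top hK hε).exists
  refine ⟨v k, hk, fun d hd => ⟨ψ k d, ?_⟩⟩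
  have h_eq : star (v k : MinTensor A D) * MinTensor.inr A D d * v k - MinTensor.inl A D (ψ k d) =
      j k ((conjStarAlgAut ℂ _ w).symm (MinTensor.inr D D d) - MinTensor.inl D D d) := by
    have h_inl : j k (MinTensor.inl D D d) = MinTensor.inl A D (ψ k d) := MinTensor.map_inl _ _ d
    have h_inr : j k (MinTensor.inr D D d) = MinTensor.inr A D d := MinTensor.map_inr _ _ d
    rw [Unitary.conjStarAlgAut_symm_apply, map_sub, map_mul, map_mul, map_star, h_inl, h_inr]
  calc _ = _ := congrArg norm h_eq
    _ ≤ ‖(conjStarAlgAut ℂ _ w).symm (MinTensor.inr D D d) - MinTensor.inl D D d‖ :=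
      NonUnitalStarAlgHom.norm_apply_le (j k) _
    _ = ‖conjStarAlgAut ℂ _ w (MinTensor.inl D D d) - MinTensor.inr D D d‖ := by
      rw [← StarAlgEquiv.norm_map (conjStarAlgAut ℂ _ w), map_sub, StarAlgEquiv.apply_symm_apply,
        norm_sub_rev]
    _ < ε := hw d hd

theorem exists_filter_forall_eventually_lt {X Y : Type*} {g : X → Y → ℝ}
    (h : ∀ (F : Finset X) (ε : ℝ), 0 < ε → ∃ y, ∀ x ∈ F, g x y < ε) :
    ∃ l : Filter Y, l.NeBot ∧ ∀ x ε, 0 < ε → ∀ᶠ y in l, g x y < ε := by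
  classical
  choose y hy using fun p : Finset X × ℕ => h p.1 (1 / ((p.2 : ℝ) + 1)) Nat.one_div_pos_of_nat
  refine ⟨map y atTop, inferInstance, fun x ε hε => ?_⟩
  obtain ⟨n, hn⟩ := exists_nat_one_div_lt hε
  refine eventually_map.2 <| (eventually_ge_atTop ({x}, n)).mono fun p hp => ?_
  exact (hy p x (hp.1 (Finset.mem_singleton_self x))).trans
    ((Nat.one_div_le_one_div hp.2).trans_lt hn)

variable {α : Circle →* (A ≃⋆ₐ[ℂ] A)}

theorem HasRokhlinProperty.exists_filter (hR : HasRokhlinProperty α) :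
    ∃ l : Filter (unitary A), l.NeBot ∧
      (∀ ζ, Tendsto (fun u : unitary A => α ζ u - (ζ : ℂ) • (u : A)) l (𝓝 0)) ∧
      ∀ a, Tendsto (fun u : unitary A => (u : A) * a - a * u) l (𝓝 0) := by
  obtain ⟨l, hl, h⟩ := exists_filter_forall_eventually_lt (Y := unitary A)
    (g := Sum.elim (fun ζ u => ‖α ζ u - (ζ : ℂ) • (u : A)‖) fun a u => ‖(u : A) * a - a * u‖)
    fun F ε hε => by
      obtain ⟨u, hu, hu_eigen, hu_central⟩ := hR F.toRight ε hε
      refine ⟨⟨u, hu⟩, Sum.forall.2 ⟨fun ζ _ => hu_eigen ζ, fun a ha => ?_⟩⟩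
      exact hu_central a (Finset.mem_toRight.2 ha)
  exact ⟨l, hl, fun ζ => NormedAddGroup.tendsto_nhds_zero.2 (h (Sum.inl ζ)),
    fun a => NormedAddGroup.tendsto_nhds_zero.2 (h (Sum.inr a))⟩

theorem IsAbsorbing.exists_unitary_orbit_conj_inr_near_inl {G : Type*} [Group G]
    [TopologicalSpace G] [CompactSpace G] {γ : G →* (A ≃⋆ₐ[ℂ] A)}
    (hγ : ∀ a, Continuous fun x => γ x a) (hD : IsStronglySelfAbsorbing D) (hA : IsAbsorbing D A)
    (F : Finset A) (T : Finset D) {ε : ℝ} (hε : 0 < ε) :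
    ∃ v : unitary (MinTensor A D),
      (∀ a ∈ F, ∀ x, ‖MinTensor.tensorAction D γ x v * MinTensor.inl A D a -
        MinTensor.inl A D a * MinTensor.tensorAction D γ x v‖ < ε) ∧
      ∀ d ∈ T, ∃ a, ‖star (v : MinTensor A D) * MinTensor.inr A D d * v -
        MinTensor.inl A D a‖ < ε := by
  have h_orbits : IsCompact (⋃ a ∈ F, Set.range fun x => γ x a) :=
    F.finite_toSet.isCompact_biUnion fun a _ => isCompact_range (hγ a)
  obtain ⟨v, hvF, hvT⟩ := hA.exists_unitary_conj_inr_near_inl hD h_orbits T hε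
  refine ⟨v, fun a ha x => ?_, hvT⟩
  have h_translate : MinTensor.inl A D a =
      MinTensor.tensorAction D γ x (MinTensor.inl A D (γ x⁻¹ a)) := by
    rw [MinTensor.tensorAction_inl, ← StarAlgEquiv.mul_apply, ← map_mul, mul_inv_cancel, map_one]
    rfl
  rw [h_translate, ← map_mul, ← map_mul, ← map_sub, StarAlgEquiv.norm_map]
  exact hvF _ (Set.mem_biUnion ha (Set.mem_range_self x⁻¹))

theorem HasRokhlinProperty.exists_almost_fixed_unitary_conj_inr_near_inl
    (hR : HasRokhlinProperty α) (hα : IsContinuousAction α) (hD : IsStronglySelfAbsorbing D)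
    (hA : IsAbsorbing D A) (C : Finset Circle) (F : Finset A) (T : Finset D) {ε : ℝ}
    (hε : 0 < ε) :
    ∃ w : unitary (MinTensor A D), (∀ c ∈ C, ‖MinTensor.tensorAction D α c w - w‖ < ε) ∧
      (∀ a ∈ F, ‖w * MinTensor.inl A D a - MinTensor.inl A D a * w‖ < ε) ∧
      ∀ d ∈ T, ∃ a, ‖star (w : MinTensor A D) * MinTensor.inr A D d * w -
        MinTensor.inl A D a‖ < ε := by
  classical
  obtain ⟨l, hl, hl_eigen, hl_central⟩ := hR.exists_filter
  obtain ⟨v, hvF, hvT⟩ := hA.exists_unitary_orbit_conj_inr_near_inl hα hD F T (half_pos hε)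
  have h_shift (c : Circle) (φ : C(Circle, ℂ)) : Tendsto (fun u : unitary A =>
      MinTensor.tensorAction D α c ((MinTensor.inl A D).comp (circleFunctionalCalculus u) φ) -
        (MinTensor.inl A D).comp (circleFunctionalCalculus u)
          (φ.comp (ContinuousMap.mulRight c))) l (𝓝 0) := by
    refine (((map_continuous (MinTensor.inl A D)).tendsto' 0 0 (map_zero _)).comp
      (tendsto_circleFunctionalCalculus_comp_mulRight (β := (α c : A →⋆ₐ[ℂ] A))
        (hl_eigen c) φ)).congr fun u => ?_
    rw [StarAlgHom.comp_apply, StarAlgHom.comp_apply, MinTensor.tensorAction_inl, ← map_sub]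
    rfl
  obtain ⟨w, hwC, hwF, hwT⟩ := exists_almost_invariant_unitary (F := F.image (MinTensor.inl A D))
    (T := T.image (MinTensor.inr A D)) (S := (MinTensor.inl A D).toAlgHom.range)
    (MinTensor.continuous_tensorAction hα)
    (isAsymptoticallyCentral_circleFunctionalCalculus hl_central).inl_comp h_shift
    (fun u φ => ⟨circleFunctionalCalculus u φ, rfl⟩)
    (by rintro ζ _ ⟨a, rfl⟩; exact ⟨α ζ a, (MinTensor.tensorAction_inl α ζ a).symm⟩)
    v C (Finset.forall_mem_image.2 fun d _ ζ => MinTensor.tensorAction_inr α ζ d)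
    (half_pos hε) (Finset.forall_mem_image.2 fun a ha ζ => (hvF a ha ζ).le)
    (Finset.forall_mem_image.2 fun d hd => (hvT d hd).imp' (MinTensor.inl A D) fun a ha =>
      ⟨⟨a, rfl⟩, ha.le⟩)
  rw [mul_div_cancel₀ ε two_ne_zero] at hwC hwF hwT
  refine ⟨w, hwC, Finset.forall_mem_image.1 hwF, fun d hd => ?_⟩
  obtain ⟨_, ⟨a, rfl⟩, ha⟩ := hwT _ (Finset.mem_image_of_mem _ hd)
  exact ⟨a, ha⟩

theorem HasRokhlinProperty.exists_invariant_filter (hR : HasRokhlinProperty α)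
    (hα : IsContinuousAction α) (hD : IsStronglySelfAbsorbing D) (hA : IsAbsorbing D A) :
    ∃ l : Filter (unitary (MinTensor A D)), l.NeBot ∧
      (∀ c, Tendsto (fun w : unitary (MinTensor A D) =>
        MinTensor.tensorAction D α c w - w) l (𝓝 0)) ∧
      (∀ a, Tendsto (fun w : unitary (MinTensor A D) =>
        w * MinTensor.inl A D a - MinTensor.inl A D a * w) l (𝓝 0)) ∧
      ∀ d, ∀ ε > 0, ∀ᶠ w : unitary (MinTensor A D) in l, ∃ a,
        ‖star (w : MinTensor A D) * MinTensor.inr A D d * w - MinTensor.inl A D a‖ < ε := by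
  let g : Circle ⊕ A ⊕ D → unitary (MinTensor A D) → ℝ :=
    Sum.elim (fun c w => ‖MinTensor.tensorAction D α c w - w‖) <|
      Sum.elim (fun a w => ‖w * MinTensor.inl A D a - MinTensor.inl A D a * w‖) fun d w =>
        Metric.infDist (star (w : MinTensor A D) * MinTensor.inr A D d * w)
          (Set.range (MinTensor.inl A D))
  obtain ⟨l, hl, h⟩ := exists_filter_forall_eventually_lt (g := g) fun F ε hε => by
    obtain ⟨w, hw_fixed, hw_central, hw_near⟩ :=
      hR.exists_almost_fixed_unitary_conj_inr_near_inl hα hD hA F.toLeft F.toRight.toLeft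
        F.toRight.toRight hε
    refine ⟨w, Sum.forall.2 ⟨fun c hc => hw_fixed c (Finset.mem_toLeft.2 hc),
      Sum.forall.2 ⟨fun a ha => ?_, fun d hd => ?_⟩⟩⟩
    · exact hw_central a (Finset.mem_toLeft.2 (Finset.mem_toRight.2 ha))
    · obtain ⟨a, ha⟩ := hw_near d (Finset.mem_toRight.2 (Finset.mem_toRight.2 hd))
      exact (Metric.infDist_le_dist_of_mem (Set.mem_range_self a)).trans_lt
        ((dist_eq_norm _ _).trans_lt ha)
  refine ⟨l, hl, fun c => NormedAddGroup.tendsto_nhds_zero.2 (h (Sum.inl c)),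
    fun a => NormedAddGroup.tendsto_nhds_zero.2 (h (Sum.inr (Sum.inl a))), fun d ε hε => ?_⟩
  filter_upwards [h (Sum.inr (Sum.inr d)) ε hε] with w hw
  obtain ⟨_, ⟨a, rfl⟩, ha⟩ := (Metric.infDist_lt_iff (Set.range_nonempty _)).1 hw
  exact ⟨a, (dist_eq_norm _ _).symm.trans_lt ha⟩

end AlmostInvariantUnitaries

section Transfer

variable {D : Type u} [CStarAlgebra D] {ι : Type*} {l : Filter ι}

theorem MinTensor.isAsymptoticallyAbsorbing_inl {B : Type u} [CStarAlgebra B] [l.NeBot]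
    {V : ι → unitary (MinTensor B D)}
    (hl : ∀ b, Tendsto (fun i => V i * inl B D b - inl B D b * V i) l (𝓝 0))
    (hr : ∀ d, ∀ ε > 0, ∀ᶠ i in l, ∃ b,
      ‖star (V i : MinTensor B D) * inr B D d * V i - inl B D b‖ < ε) :
    IsAsymptoticallyAbsorbing (inl B D) := by
  let f (i : ι) : MinTensor B D →⋆ₐ[ℂ] MinTensor B D :=
    (conjStarAlgAut ℂ (MinTensor B D) (V i)).symm
  have hf (i : ι) (x : MinTensor B D) : f i x = star (V i : MinTensor B D) * x * V i :=
    Unitary.conjStarAlgAut_symm_apply (S := ℂ) (V i) x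
  have h_top : asymptoticPreimage l f (inl B D).toAlgHom.range = ⊤ := by
    refine subalgebra_eq_top (isClosed_asymptoticPreimage _ _) (fun b ε hε => ?_)
      fun d ε hε => ?_
    · filter_upwards [NormedAddGroup.tendsto_nhds_zero.1 (hl b) ε hε] with i hi
      refine ⟨inl B D b, ⟨b, rfl⟩, ?_⟩
      rwa [← norm_conjStarAlgAut_sub_self, ← StarAlgEquiv.norm_map (conjStarAlgAut ℂ _ (V i)).symm,
        map_sub, StarAlgEquiv.symm_apply_apply, norm_sub_rev] at hi
    · filter_upwards [hr d ε hε] with i ⟨b, hb⟩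
      exact ⟨inl B D b, ⟨b, rfl⟩, by rwa [hf]⟩
  intro F S ε hε
  have h_eventually := ((Finset.eventually_all F).2 fun b _ =>
    NormedAddGroup.tendsto_nhds_zero.1 (hl b) ε hε).and <|
    (Finset.eventually_all S).2 fun c _ => (h_top ▸ Algebra.mem_top :
      c ∈ asymptoticPreimage l f (inl B D).toAlgHom.range) ε hε
  obtain ⟨i, hiF, hiS⟩ := h_eventually.exists
  refine ⟨V i, fun b hb => (norm_conjStarAlgAut_sub_self _ _).trans_lt (hiF b hb),
    fun c hc => ?_⟩
  obtain ⟨_, ⟨b, rfl⟩, hb⟩ := hiS c hc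
  refine ⟨b, lt_of_eq_of_lt ?_ hb⟩
  rw [← StarAlgEquiv.norm_map (conjStarAlgAut ℂ _ (V i)).symm, map_sub,
    StarAlgEquiv.symm_apply_apply]
  rfl

/-- The elements of `B` on which `u` intertwines the homomorphisms `f` and `g`. -/
def intertwinedSubalgebra {B E : Type*} [CStarAlgebra B] [CStarAlgebra E] (u : E)
    (f g : B →⋆ₐ[ℂ] E) : Subalgebra ℂ B where
  carrier := {b | SemiconjBy u (f b) (g b)}
  mul_mem' {b c} hb hc := by
    simpa only [Set.mem_ofPred_eq, map_mul] using SemiconjBy.mul_right hb hc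
  add_mem' {b c} hb hc := by
    simpa only [Set.mem_ofPred_eq, map_add] using SemiconjBy.add_right hb hc
  algebraMap_mem' z := by
    rw [Set.mem_ofPred_eq, AlgHomClass.commutes, AlgHomClass.commutes]
    exact (Algebra.commutes z u).symm

theorem mem_intertwinedSubalgebra {B E : Type*} [CStarAlgebra B] [CStarAlgebra E] {u : E}
    {f g : B →⋆ₐ[ℂ] E} {b : B} :
    b ∈ intertwinedSubalgebra u f g ↔ SemiconjBy u (f b) (g b) :=
  Iff.rfl

theorem isClosed_intertwinedSubalgebra {B E : Type*} [CStarAlgebra B] [CStarAlgebra E] (u : E)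
    (f g : B →⋆ₐ[ℂ] E) : IsClosed (intertwinedSubalgebra u f g : Set B) :=
  isClosed_eq (continuous_const.mul (map_continuous f)) ((map_continuous g).mul continuous_const)

namespace CrossedProduct

variable {A : Type u} [CStarAlgebra A] {G : Type} [Group G] [Fintype G] [DecidableEq G]
  {γ : G →* (A ≃⋆ₐ[ℂ] A)}

open MinTensor hiding subalgebra_eq_top isAsymptoticallyAbsorbing_inl separableSpace

theorem semiconjBy_inl_gen_map_embed (s : G) (x : MinTensor A D) :
    SemiconjBy (inl _ D (gen γ s)) (map (embed γ) (StarAlgHom.id ℂ D) x)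
      (map (embed γ) (StarAlgHom.id ℂ D) (tensorAction D γ s x)) := by
  let j : MinTensor A D →⋆ₐ[ℂ] MinTensor (CrossedProduct γ) D := map (embed γ) (StarAlgHom.id ℂ D)
  let σ : MinTensor A D →⋆ₐ[ℂ] MinTensor A D := tensorAction D γ s
  have h_top : intertwinedSubalgebra (inl _ D (gen γ s)) j (j.comp σ) = ⊤ := by
    refine MinTensor.subalgebra_eq_top (isClosed_intertwinedSubalgebra _ _ _) (fun a => ?_)
      fun d => ?_
    · have hj (b : A) : j (inl A D b) = inl _ D (embed γ b) := map_inl _ _ b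
      have hσ : σ (inl A D a) = inl A D (γ s a) := tensorAction_inl γ s a
      rw [mem_intertwinedSubalgebra, StarAlgHom.comp_apply, hσ, hj, hj]
      exact SemiconjBy.map (gen_mul_embed γ s a) (inl (CrossedProduct γ) D)
    · have hj : j (inr A D d) = inr _ D d := map_inr _ _ d
      have hσ : σ (inr A D d) = inr A D d := tensorAction_inr γ s d
      rw [mem_intertwinedSubalgebra, StarAlgHom.comp_apply, hσ, hj]
      exact commute_inl_inr (gen γ s) d
  have h_mem : x ∈ intertwinedSubalgebra (inl _ D (gen γ s)) j (j.comp σ) :=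
    h_top ▸ Algebra.mem_top
  rw [mem_intertwinedSubalgebra, StarAlgHom.comp_apply] at h_mem
  exact h_mem

theorem asymptoticCommutant_inl_eq_top {W : ι → unitary (MinTensor A D)}
    (hW_fixed : ∀ s, Tendsto (fun i => tensorAction D γ s (W i) - W i) l (𝓝 0))
    (hW_central : ∀ a, Tendsto (fun i => W i * inl A D a - inl A D a * W i) l (𝓝 0)) :
    asymptoticCommutant l (fun _ => inl (CrossedProduct γ) D)
      (fun i => map (embed γ) (StarAlgHom.id ℂ D) (W i)) = ⊤ := by
  let j : MinTensor A D →⋆ₐ[ℂ] MinTensor (CrossedProduct γ) D := map (embed γ) (StarAlgHom.id ℂ D)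
  have hW_norm (i : ι) : ‖j (W i)‖ ≤ 1 := by
    nontriviality MinTensor (CrossedProduct γ) D
    exact (CStarRing.norm_of_mem_unitary (Unitary.map_mem j (W i).2)).le
  refine subalgebra_eq_top (isClosed_asymptoticCommutant hW_norm)
    (fun a => mem_asymptoticCommutant.2 ?_) fun s => mem_asymptoticCommutant.2 ?_
  · rw [← MinTensor.map_inl (embed γ) (StarAlgHom.id ℂ D) a]
    exact tendsto_map_commutator j (hW_central a)
  · have h_fixed := (((map_continuous j).tendsto' 0 0 (map_zero j)).comp
      (hW_fixed s)).mul_const (-inl _ D (gen γ s))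
    rw [zero_mul] at h_fixed
    refine h_fixed.congr fun i => ?_
    rw [(semiconjBy_inl_gen_map_embed s _).eq, Function.comp_apply, map_sub, mul_neg, sub_mul,
      neg_sub]

theorem isAsymptoticallyAbsorbing_inl [l.NeBot] {W : ι → unitary (MinTensor A D)}
    (hW_fixed : ∀ s, Tendsto (fun i => tensorAction D γ s (W i) - W i) l (𝓝 0))
    (hW_central : ∀ a, Tendsto (fun i => W i * inl A D a - inl A D a * W i) l (𝓝 0))
    (hW_near : ∀ d, ∀ ε > 0, ∀ᶠ i in l, ∃ a,
      ‖star (W i : MinTensor A D) * inr A D d * W i - inl A D a‖ < ε) :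
    IsAsymptoticallyAbsorbing (inl (CrossedProduct γ) D) := by
  let j : MinTensor A D →⋆ₐ[ℂ] MinTensor (CrossedProduct γ) D := map (embed γ) (StarAlgHom.id ℂ D)
  refine MinTensor.isAsymptoticallyAbsorbing_inl (l := l)
    (V := fun i => ⟨j (W i), Unitary.map_mem j (W i).2⟩) (fun b => ?_) fun d ε hε => ?_
  · exact mem_asymptoticCommutant.1
      (asymptoticCommutant_inl_eq_top hW_fixed hW_central ▸ Algebra.mem_top)
  · filter_upwards [hW_near d ε hε] with i ⟨a, ha⟩
    refine ⟨embed γ a, lt_of_eq_of_lt (congrArg norm ?_)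
      ((NonUnitalStarAlgHom.norm_apply_le j _).trans_lt ha)⟩
    have h_inl : j (inl A D a) = inl _ D (embed γ a) := MinTensor.map_inl _ _ a
    have h_inr : j (inr A D d) = inr _ D d := MinTensor.map_inr _ _ d
    rw [map_sub, map_mul, map_mul, map_star, h_inl, h_inr]

end CrossedProduct

end Transfer

theorem IsAsymptoticallyAbsorbing.isAbsorbing {B D : Type u} [CStarAlgebra B] [CStarAlgebra D]
    [TopologicalSpace.SeparableSpace B] (hD : IsStronglySelfAbsorbing D)
    (h : IsAsymptoticallyAbsorbing (MinTensor.inl B D)) : IsAbsorbing D B := by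
  have := hD.separable
  have : Nontrivial D := not_subsingleton_iff_nontrivial.1 fun _ =>
    hD.infinite_dimensional inferInstance
  have := MinTensor.separableSpace (A := B) (D := D)
  exact (h.nonempty_starAlgEquiv MinTensor.inl_injective).map StarAlgEquiv.symm

theorem mainTheorem10_general {D A : Type u} [CStarAlgebra D] [CStarAlgebra A] [Nontrivial A]
    [TopologicalSpace.SeparableSpace A]
    (hD : IsStronglySelfAbsorbing D) (hA : IsAbsorbing D A)
    (α : Circle →* (A ≃⋆ₐ[ℂ] A)) (hα : IsContinuousAction α) (hR : HasRokhlinProperty α)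
    {G : Type} [Group G] [Fintype G] [DecidableEq G] (κ : G →* Circle) :
    Nontrivial (CrossedProduct (α.comp κ)) ∧
      TopologicalSpace.SeparableSpace (CrossedProduct (α.comp κ)) ∧
      IsAbsorbing D (CrossedProduct (α.comp κ)) := by
  have h_separable := CrossedProduct.separableSpace (α := α.comp κ)
  obtain ⟨l, hl, h_fixed, h_central, h_near⟩ := hR.exists_invariant_filter hα hD hA
  exact ⟨CrossedProduct.nontrivial, h_separable,
    (CrossedProduct.isAsymptoticallyAbsorbing_inl (fun s => by
      simpa only [MinTensor.tensorAction_comp] using h_fixed (κ s)) h_central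
      h_near).isAbsorbing hD⟩

theorem mainTheorem10 {D A : Type u} [CStarAlgebra D] [CStarAlgebra A] [Nontrivial A]
    [TopologicalSpace.SeparableSpace A]
    (hD : IsStronglySelfAbsorbing D) (hA : IsAbsorbing D A)
    (α : Circle →* (A ≃⋆ₐ[ℂ] A)) (hα : IsContinuousAction α) (hR : HasRokhlinProperty α)
    (n : ℕ) [NeZero n] :
    Nontrivial (CrossedProduct (restrictCyclic α n)) ∧
      TopologicalSpace.SeparableSpace (CrossedProduct (restrictCyclic α n)) ∧
      IsAbsorbing D (CrossedProduct (restrictCyclic α n)) :=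
  mainTheorem10_general hD hA α hα hR (ZMod.toCircle (N := n)).toMonoidHom
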